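/- Let $T_f,N_t\ge 1$ be integers, $\sigma>0$, $\alpha_1,\dots,\alpha_{T_f}>0$, and $T=T_fT_s$. Put $f(g)=\frac1{T_f}\sum_{j=1}^{T_f}\frac{\sigma^2}{\alpha_j}\,\frac{(\sigma^2g/\alpha_j)^{N_t-1}}{\Gamma(N_t)}e^{-\sigma^2g/\alpha_j}$ for $g>0$ and $f(g)=0$ for $g\le0$. For every $T_s$ let the equivalent channel gains $g^1,\dots,g^T$ be either (a) $g^t=\alpha_{\lceil t/T_s\rceil}\|\mathbf h^t\|^2/\sigma^2$, where $\mathbf h^1,\dots,\mathbf h^T\in\mathbb C^{N_t}$ have i.i.d. circularly symmetric complex Gaussian entries (Rayleigh fading) of unit mean power, or (b) i.i.d. with density $f$. Let $0<\kappa<1$, and let $N=N_T$ slots be scheduled, where $N_T/T\to\kappa$ as $T_s\to\infty$ (for instance $N_T=\lfloor\kappa T\rfloor$, which is $\kappa T$ whenever this is an integer). Let $R=R_T>0$ be the demand in nats, with $R_T/T\to\rho$, where $\rho\ge0$ (for instance $R_T=R$ fixed, with $\rho=0$). Let $g^{[1]}\ge g^{[2]}\ge\dots\ge g^{[T]}$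 be the ordered gains, $g_{\rm th}=g^{[N]}$, let $g_{[1-\kappa]}$ satisfy $\int_{g_{[1-\kappa]}}^\infty f(g)\,dg=\kappa$, and put $$\mu_\Phi=\int_{g_{[1-\kappa]}}^\infty \frac{f(g)\ln g}{\kappa}\,dg,\qquad \mu_g=\int_{g_{[1-\kappa]}}^\infty\frac{f(g)}{g\kappa}\,dg,\qquad \bar\nu=e^{\rho/\kappa-\mu_\Phi}.$$ Say that random variables $X_T$ *converge well* to $m$ if, as $T_s\to\infty$, they eventually have finite second moments, $\mathbb E X_T\to m$, $\mathrm{Var}\,X_T\to0$, and $\Pr(|X_T-m|\ge\varepsilon)\to0$ for every $\varepsilon>0$. (i) The level and the transmit power per slot given by the formulas valid for $\nu g_{\rm th}\ge1$, namely $$\nu=\exp\Big(\frac RN-\frac1N\sum_{i=1}^N\ln g^{[i]}\Big),\qquad \Psi_p=\frac NT\,\nu-\frac1T\sum_{i=1}^N\frac1{g^{[i]}},$$ converge well to $\bar\nu$ and to $\kappa\bar\nu-\kappa\mu_g$, respectively. Thus $\lim\mu_\nu=\bar\nu$, $\lim\mu_{\Psi_p}=\lim\kappa\mu_\nu-\kappa\mu_g$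 and $\lim\sigma^2_{\Psi_p}=0$, where $\mu$ and $\sigma^2$ denote mean and variance. (ii) Let $\nu$ now be the actual water-filling level, i.e. a random variable with $\nu=\exp\big(\frac RL-\frac1L\sum_{t\in\mathcal L}\ln g^t\big)$ almost surely, where $\mathcal L=\{t: g^t\ge\max\{g_{\rm th},1/\nu\}\}$ is nonempty and $L=|\mathcal L|$, and let $\Psi_p=\frac1T\sum_{t\in\mathcal L}\big(\nu-\frac1{g^t}\big)$ be the actual transmit power per slot. If the probability of the event $\nu g_{\rm th}\ge1$ is bounded below by a positive constant for all large $T_s$, then, conditionally on this event, $\nu$ and $\Psi_p$ converge well to $\bar\nu$ and to $\kappa\bar\nu-\kappa\mu_g$. If this probability tends to $1$, they also do so unconditionally. -/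

import Mathlib

open MeasureTheory ProbabilityTheory Filter Topology

noncomputable section

namespace PredictiveAllocation

/-! ### Ordered gains, threshold, water-filling -/

/-- The `i`-th largest value (`i = 1, …, n`) of the tuple `g`, i.e. `g^{[i]}`. -/
def largest {n : ℕ} (g : Fin n → ℝ) (i : ℕ) : ℝ :=
  if h : 1 ≤ i ∧ i ≤ n then g (Tuple.sort g ⟨n - i, by omega⟩) else 0

/-- The threshold `g_th` that selects the `N` slots with the largest gains. -/
def threshold {n : ℕ} (g : Fin n → ℝ) (N : ℕ) : ℝ := largest g N

/-- The scheduled slots that get power under the level `ν`: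
those with `g^t ≥ max {g_th, 1/ν}`. -/
def activeSlots {n : ℕ} (g : Fin n → ℝ) (N : ℕ) (ν : ℝ) : Finset (Fin n) :=
  Finset.univ.filter fun t => max (threshold g N) (1 / ν) ≤ g t

/-- `ν` is the water-filling level for `N` scheduled slots and a demand of `R` nats:
`ν = exp (R / L - (1 / L) ∑_{t ∈ 𝓛} ln g^t)`, where `𝓛` is the (nonempty) set of the slots
that get power under `ν` and `L` is its cardinality. -/
def IsWaterLevel {n : ℕ} (g : Fin n → ℝ) (N : ℕ) (R ν : ℝ) : Prop :=
  (activeSlots g N ν).Nonempty ∧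
    ν = Real.exp (R / (activeSlots g N ν).card
      - 1 / ((activeSlots g N ν).card : ℝ) * ∑ t ∈ activeSlots g N ν, Real.log (g t))

/-- The transmit power `p^t = (ν - 1 / g^t) 1(g^t ≥ max {g_th, 1/ν})` in slot `t`. -/
def slotPower {n : ℕ} (g : Fin n → ℝ) (N : ℕ) (ν : ℝ) (t : Fin n) : ℝ :=
  if t ∈ activeSlots g N ν then ν - 1 / g t else 0

/-- The transmit power per slot `(1 / n) ∑_t p^t`. -/
def transmitPower {n : ℕ} (g : Fin n → ℝ) (N : ℕ) (ν : ℝ) : ℝ :=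
  1 / (n : ℝ) * ∑ t, slotPower g N ν t

/-- The water-filling level when all `N` scheduled slots get power:
`exp (R / N - (1 / N) ∑_{i=1}^N ln g^{[i]})`. -/
def fullLevel {n : ℕ} (g : Fin n → ℝ) (N : ℕ) (R : ℝ) : ℝ :=
  Real.exp (R / N - 1 / (N : ℝ) * ∑ i ∈ Finset.Icc 1 N, Real.log (largest g i))

/-- The transmit power per slot when all `N` scheduled slots get power:
`κ ν - (1 / n) ∑_{i=1}^N 1 / g^{[i]}` with `κ = N / n`. -/
def fullPower {n : ℕ} (g : Fin n → ℝ) (N : ℕ) (R : ℝ) : ℝ :=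
  (N : ℝ) / n * fullLevel g N R - 1 / (n : ℝ) * ∑ i ∈ Finset.Icc 1 N, 1 / largest g i

/-! ### The channel -/

/-- The law of a Rayleigh fading coefficient of unit mean power: a circularly symmetric complex
Gaussian, whose real and imaginary parts are independent centered with variance `1 / 2`. -/
def rayleighLaw : Measure ℂ :=
  ((gaussianReal 0 (1 / 2)).prod (gaussianReal 0 (1 / 2))).map
    Complex.measurableEquivRealProd.symm

/-- The probability density
`f(g) = (1 / T_f) ∑_j (σ² / α_j) (σ² g / α_j) ^ (N_t - 1) exp (-σ² g / α_j) / Γ(N_t)`, `g > 0`. -/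
def gainPDF {Tf : ℕ} (α : Fin Tf → ℝ) (σ : ℝ) (Nt : ℕ) (g : ℝ) : ℝ :=
  if 0 < g then
    1 / (Tf : ℝ) * ∑ j, σ ^ 2 / α j *
      ((σ ^ 2 / α j * g) ^ (Nt - 1) / Real.Gamma Nt * Real.exp (-(σ ^ 2 / α j * g)))
  else 0

variable {Ω : Type*} [MeasurableSpace Ω]

/-- `G Ts t` is the equivalent channel gain `α_j ‖h^t‖² / σ²` in slot `t`, with `Tf` frames of `Ts`
slots each, `j` the frame of `t`, and `h^t` a vector of `Nt` Rayleigh coefficients, all the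
coefficients of all the slots being independent. -/
def IsBlockFadingGain (P : Measure Ω) {Tf : ℕ} (α : Fin Tf → ℝ) (σ : ℝ) (Nt : ℕ)
    (G : (Ts : ℕ) → Fin (Tf * Ts) → Ω → ℝ) : Prop :=
  ∃ h : (Ts : ℕ) → Fin (Tf * Ts) → Ω → EuclideanSpace ℂ (Fin Nt),
    (∀ Ts, iIndepFun (fun (p : Fin (Tf * Ts) × Fin Nt) ω => h Ts p.1 ω p.2) P) ∧
    (∀ Ts t k, HasLaw (fun ω => h Ts t ω k) rayleighLaw P) ∧
    ∀ Ts t ω, G Ts t ω = α t.divNat * ‖h Ts t ω‖ ^ 2 / σ ^ 2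

/-- For each `Ts` the `Tf * Ts` gains are i.i.d. with density `gainPDF α σ Nt`. -/
def IsIIDGain (P : Measure Ω) {Tf : ℕ} (α : Fin Tf → ℝ) (σ : ℝ) (Nt : ℕ)
    (G : (Ts : ℕ) → Fin (Tf * Ts) → Ω → ℝ) : Prop :=
  (∀ Ts, iIndepFun (G Ts) P) ∧
    ∀ Ts t, HasLaw (G Ts t)
      (volume.withDensity fun g => ENNReal.ofReal (gainPDF α σ Nt g)) P

/-! ### Mean and variance limits -/

/-- Under the laws `Q k`, the variables `X k` have finite second moments for large `k`, their means
tend to `m` and their variances to `0`, and they concentrate at `m`. -/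
def HasMeanLimitAndConcentrates (Q : ℕ → Measure Ω) (X : ℕ → Ω → ℝ) (m : ℝ) : Prop :=
  (∀ᶠ k in atTop, MemLp (X k) 2 (Q k)) ∧
  Tendsto (fun k => ∫ ω, X k ω ∂(Q k)) atTop (𝓝 m) ∧
  Tendsto (fun k => variance (X k) (Q k)) atTop (𝓝 0) ∧
  ∀ ε : ℝ, 0 < ε → Tendsto (fun k => Q k {ω | ε ≤ |X k ω - m|}) atTop (𝓝 0)

end PredictiveAllocation

end

/-!
Almost surely the gains are positive and pairwise distinct, since their laws have densities on
`(0, ∞)`. In both fading models the `T` gains are independent and the mean of their laws is the law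
with density `f`: in block fading, `α ‖h‖² / σ²` has a Gamma law, as its characteristic function
shows (`map_norm_sq_rayleigh`), and every frame has the same number of slots. This is all that the
limit theorems use (`IsIndepSample`, `IsRegularGainLaw`).

Sums over the `N` largest gains. Let `M` be the number of gains above the quantile `q`. By the weak
law of large numbers `M / T → κ` in mean square, so the sum of `φ` over the `N` largest gains and
the sum of `φ` over the gains above `q` differ by `|N - M| = o(T)` terms, whose values lie between
those at `q` and at the threshold (`abs_sum_largest_sub_sum_exceed_le`). The second sum is again
governed by the law of large numbers. This gives the limits for `φ = log` and `φ = 1 / x`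
(`tendstoMeanSq_sum_largest`), once the values at the threshold have bounded fourth moments.

That bound is the only uniform estimate needed. At least a fixed proportion `c` of the gains lies on
either side of the threshold, hence `|log g_th| ≤ (1 / (c T)) ∑ |log g|`. The fourth moment of the
exponential of the right-hand side is a product over the independent gains, each factor being
`1 + O(1 / T)` because `E exp (|log g| / 2)` is finite (`IsIndepSample.exp_moment_le`,
`logSpread_fourth_moment`). The same estimate bounds the level by `exp (R / N) / g_th`, so that
convergence in probability of its exponent gives convergence in mean square
(`tendstoMeanSq_fullLevel`). Mean-square convergence is equivalent to the convergence of means,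
variances and probabilities that is asserted.

For the actual level `ν`: on the event `ν g_th ≥ 1` all the `N` scheduled slots are active, so `ν`
and the power agree there with the explicit formulas. Almost surely `ν` is at most the level of the formula
(`IsWaterLevel.le_fullLevel`), and the power per slot lies between `0` and `ν`. Conditioning on an
event of probability bounded below preserves mean-square limits, and the domination makes the
complement negligible when its probability tends to zero.
-/

noncomputable section

namespace PredictiveAllocation

/-! ### Order statistics of a finite sample -/

section OrderStatistics

variable {n : ℕ} {g : Fin n → ℝ}

theorem sum_largest {M : Type*} [AddCommMonoid M] (g : Fin n → ℝ) (ψ : ℝ → M) :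
    ∑ i ∈ Finset.Icc 1 n, ψ (largest g i) = ∑ t, ψ (g t) := by
  have h1 : ∑ i ∈ Finset.Icc 1 n, ψ (largest g i)
      = ∑ k : Fin n, ψ (largest g (k + 1)) := by
    rw [Fin.sum_univ_eq_sum_range (fun k => ψ (largest g (k + 1))) n, Finset.range_eq_Ico,
      Finset.sum_Ico_add' (fun k => ψ (largest g k)) 0 n 1]
    rfl
  rw [h1, ← Equiv.sum_comp (Fin.revPerm.trans (Tuple.sort g)) fun t => ψ (g t)]
  refine Finset.sum_congr rfl fun k _ => ?_
  have hk : 1 ≤ (k : ℕ) + 1 ∧ (k : ℕ) + 1 ≤ n := ⟨by omega, k.2⟩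
  rw [largest, dif_pos hk]
  rfl

theorem sum_filter_largest {M : Type*} [AddCommMonoid M] (g : Fin n → ℝ) (p : ℝ → Prop)
    [DecidablePred p] (ψ : ℝ → M) :
    ∑ i ∈ Finset.Icc 1 n with p (largest g i), ψ (largest g i)
      = ∑ t ∈ Finset.univ.filter fun t => p (g t), ψ (g t) := by
  rw [Finset.sum_filter, Finset.sum_filter]
  exact sum_largest g fun x => if p x then ψ x else 0

theorem card_filter_largest (g : Fin n → ℝ) (p : ℝ → Prop) [DecidablePred p] :
    ((Finset.Icc 1 n).filter fun i => p (largest g i)).card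
      = (Finset.univ.filter fun t => p (g t)).card := by
  simpa using sum_filter_largest g p fun _ => (1 : ℕ)

theorem largest_le_largest {i j : ℕ} (hi : 1 ≤ i) (hij : i ≤ j) (hj : j ≤ n) :
    largest g j ≤ largest g i := by
  rw [largest, largest, dif_pos ⟨hi.trans hij, hj⟩, dif_pos ⟨hi, hij.trans hj⟩]
  exact Tuple.monotone_sort g (Fin.mk_le_mk.2 (by omega))

theorem largest_lt_largest (hg : Function.Injective g) {i j : ℕ} (hi : 1 ≤ i) (hij : i < j)
    (hj : j ≤ n) : largest g j < largest g i := by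
  refine lt_of_le_of_ne (largest_le_largest hi hij.le hj) ?_
  rw [largest, largest, dif_pos ⟨hi.trans hij.le, hj⟩, dif_pos ⟨hi, hij.le.trans hj⟩]
  intro h
  have := (Tuple.sort g).injective (hg h)
  simp only [Fin.mk.injEq] at this
  omega

theorem largest_pos (hg : ∀ t, 0 < g t) {i : ℕ} (hi : 1 ≤ i) (hn : i ≤ n) : 0 < largest g i := by
  rw [largest, dif_pos ⟨hi, hn⟩]
  exact hg _

/-- Order statistics in terms of counts, which depend measurably on the sample. -/
theorem lt_largest_iff {i : ℕ} (hi : 1 ≤ i) (hn : i ≤ n) (x : ℝ) :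
    x < largest g i ↔ i ≤ (Finset.univ.filter fun t => x < g t).card := by
  rw [← card_filter_largest g fun y => x < y]
  constructor
  · intro h
    have hsub : Finset.Icc 1 i ⊆ (Finset.Icc 1 n).filter fun j => x < largest g j := by
      intro j hj
      rw [Finset.mem_Icc] at hj
      exact Finset.mem_filter.2 ⟨Finset.mem_Icc.2 ⟨hj.1, hj.2.trans hn⟩,
        h.trans_le (largest_le_largest hj.1 hj.2 hn)⟩
    simpa using Finset.card_le_card hsub
  · intro h
    by_contra! hx
    have hsub : ((Finset.Icc 1 n).filter fun j => x < largest g j) ⊆ Finset.Icc 1 (i - 1) := by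
      intro j hj
      rw [Finset.mem_filter, Finset.mem_Icc] at hj
      rw [Finset.mem_Icc]
      refine ⟨hj.1.1, ?_⟩
      by_contra! hlt
      exact absurd (hj.2.trans_le (largest_le_largest hi (by omega) hj.1.2)) (not_lt.2 hx)
    have := Finset.card_le_card hsub
    rw [Nat.card_Icc] at this
    omega

@[fun_prop]
theorem measurable_largest (i : ℕ) : Measurable fun g : Fin n → ℝ => largest g i := by
  by_cases h : 1 ≤ i ∧ i ≤ n
  · refine measurable_of_Ioi fun x => ?_
    have hset : (fun g : Fin n → ℝ => largest g i) ⁻¹' Set.Ioi x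
        = (fun g : Fin n → ℝ => ∑ t, if x < g t then 1 else 0) ⁻¹' Set.Ici i := by
      ext g
      simp only [Set.mem_preimage, Set.mem_Ioi, Set.mem_Ici]
      rw [lt_largest_iff h.1 h.2, Finset.card_filter]
    rw [hset]
    refine measurableSet_Ici.preimage (Finset.measurable_sum _ fun t _ => ?_)
    exact Measurable.ite (measurableSet_lt measurable_const (measurable_pi_apply t))
      measurable_const measurable_const
  · have : (fun g : Fin n → ℝ => largest g i) = fun _ => 0 := by
      funext g
      rw [largest, dif_neg h]
    rw [this]
    exact measurable_const

/-- The indices `i ≤ N` and the indices of the values above `q` are two initial segments of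
`1, …, n`, so the two sums differ by terms whose values lie between the threshold and `q`. -/
theorem abs_sum_largest_sub_sum_exceed_le {N : ℕ} (hN : 1 ≤ N) (hNn : N ≤ n) (φ : ℝ → ℝ)
    (q V : ℝ) (hV : ∀ x ∈ Set.uIcc (largest g N) q, |φ x| ≤ V) :
    |∑ i ∈ Finset.Icc 1 N, φ (largest g i)
        - ∑ t ∈ Finset.univ.filter fun t => q < g t, φ (g t)|
      ≤ |(N : ℝ) - (Finset.univ.filter fun t => q < g t).card| * V := by
  rw [← sum_filter_largest g (fun y => q < y), ← card_filter_largest g (fun y => q < y)]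
  set A := Finset.Icc 1 N with hA
  set B := (Finset.Icc 1 n).filter fun i => q < largest g i with hB
  have hcard : (A.card : ℝ) = N := by simp [hA]
  rw [← hcard]
  by_cases hq : q < largest g N
  · have hAB : A ⊆ B := by
      intro i hi
      rw [hA, Finset.mem_Icc] at hi
      exact Finset.mem_filter.2 ⟨Finset.mem_Icc.2 ⟨hi.1, hi.2.trans hNn⟩,
        hq.trans_le (largest_le_largest hi.1 hi.2 hNn)⟩
    rw [← Finset.sum_sdiff hAB, ← Finset.card_sdiff_add_card_eq_card hAB]
    push_cast
    rw [show ∀ x y : ℝ, x - (y + x) = -y by intros; ring,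
      show ∀ x y : ℝ, x - (y + x) = -y by intros; ring, abs_neg, abs_neg, Nat.abs_cast,
      ← nsmul_eq_mul]
    refine (Finset.abs_sum_le_sum_abs _ _).trans (Finset.sum_le_card_nsmul _ _ _ fun i hi => ?_)
    rw [Finset.mem_sdiff, hB, Finset.mem_filter, hA, Finset.mem_Icc, Finset.mem_Icc] at hi
    refine hV _ (Set.mem_uIcc.2 (Or.inr ⟨hi.1.2.le, largest_le_largest hN ?_ hi.1.1.2⟩))
    omega
  · have hBA : B ⊆ A := by
      intro i hi
      rw [hB, Finset.mem_filter, Finset.mem_Icc] at hi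
      rw [hA, Finset.mem_Icc]
      refine ⟨hi.1.1, ?_⟩
      by_contra! hlt
      exact hq (hi.2.trans_le (largest_le_largest hN hlt.le hi.1.2))
    rw [← Finset.sum_sdiff hBA, ← Finset.card_sdiff_add_card_eq_card hBA]
    push_cast
    rw [add_sub_cancel_right, add_sub_cancel_right, Nat.abs_cast, ← nsmul_eq_mul]
    refine (Finset.abs_sum_le_sum_abs _ _).trans (Finset.sum_le_card_nsmul _ _ _ fun i hi => ?_)
    rw [Finset.mem_sdiff, hB, Finset.mem_filter, hA, Finset.mem_Icc, Finset.mem_Icc] at hi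
    have hin : i ≤ n := hi.1.2.trans hNn
    refine hV _ (Set.mem_uIcc.2 (Or.inl ⟨largest_le_largest hi.1.1 hi.1.2 hNn, ?_⟩))
    by_contra! hlt
    exact hi.2 ⟨⟨hi.1.1, hin⟩, hlt⟩

/-- At least `min N (n - N + 1)` of the values lie on the far side of the threshold from `1`. -/
theorem abs_log_largest_le (hg : ∀ t, 0 < g t) {N m : ℕ} (hN : 1 ≤ N) (hNn : N ≤ n)
    (hm : 1 ≤ m) (hmN : m ≤ N) (hmn : m + N ≤ n + 1) :
    |Real.log (largest g N)| ≤ 1 / (m : ℝ) * ∑ t, |Real.log (g t)| := by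
  have hm0 : (0 : ℝ) < m := by exact_mod_cast hm
  rw [one_div, ← div_eq_inv_mul, le_div_iff₀ hm0, ← sum_largest g fun x => |Real.log x|, mul_comm,
    ← nsmul_eq_mul]
  have key : ∀ S ⊆ Finset.Icc 1 n, m ≤ S.card →
      (∀ i ∈ S, |Real.log (largest g N)| ≤ |Real.log (largest g i)|) →
      m • |Real.log (largest g N)| ≤ ∑ i ∈ Finset.Icc 1 n, |Real.log (largest g i)| := by
    intro S hS hc h
    calc m • |Real.log (largest g N)| ≤ S.card • |Real.log (largest g N)| :=
          nsmul_le_nsmul_left (abs_nonneg _) hc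
      _ ≤ ∑ i ∈ S, |Real.log (largest g i)| := Finset.card_nsmul_le_sum _ _ _ h
      _ ≤ _ := Finset.sum_le_sum_of_subset_of_nonneg hS fun i _ _ => abs_nonneg _
  rcases le_total 1 (largest g N) with h1 | h1
  · refine key (Finset.Icc 1 N) (Finset.Icc_subset_Icc le_rfl hNn) (by simpa using hmN) ?_
    intro i hi
    rw [Finset.mem_Icc] at hi
    have hle := largest_le_largest (g := g) hi.1 hi.2 hNn
    rw [abs_of_nonneg (Real.log_nonneg h1), abs_of_nonneg (Real.log_nonneg (h1.trans hle))]
    exact Real.log_le_log (by linarith) hle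
  · refine key (Finset.Icc N n) (Finset.Icc_subset_Icc hN le_rfl) (by simp; omega) ?_
    intro i hi
    rw [Finset.mem_Icc] at hi
    have hle := largest_le_largest (g := g) hN hi.1 hi.2
    have hi0 := largest_pos hg (hN.trans hi.1) hi.2
    rw [abs_of_nonpos (Real.log_nonpos (largest_pos hg hN hNn).le h1),
      abs_of_nonpos (Real.log_nonpos hi0.le (hle.trans h1))]
    exact neg_le_neg (Real.log_le_log hi0 hle)

end OrderStatistics

/-! ### Water-filling -/

section WaterFilling

variable {n : ℕ} {g : Fin n → ℝ} {N : ℕ} {R ν : ℝ}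

theorem fullLevel_pos (g : Fin n → ℝ) (N : ℕ) (R : ℝ) : 0 < fullLevel g N R := Real.exp_pos _

theorem log_fullLevel (hN : 1 ≤ N) :
    N * Real.log (fullLevel g N R) + ∑ i ∈ Finset.Icc 1 N, Real.log (largest g i) = R := by
  have : (N : ℝ) ≠ 0 := by positivity
  rw [fullLevel, Real.log_exp]
  field_simp
  ring

theorem IsWaterLevel.pos (h : IsWaterLevel g N R ν) : 0 < ν := by
  rw [h.2]
  exact Real.exp_pos _

theorem IsWaterLevel.log_eq (h : IsWaterLevel g N R ν) :
    (activeSlots g N ν).card * Real.log ν + ∑ t ∈ activeSlots g N ν, Real.log (g t) = R := by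
  have hc : ((activeSlots g N ν).card : ℝ) ≠ 0 := by exact_mod_cast h.1.card_pos.ne'
  have hlog : Real.log ν = R / (activeSlots g N ν).card
      - 1 / ((activeSlots g N ν).card : ℝ) * ∑ t ∈ activeSlots g N ν, Real.log (g t) := by
    conv_lhs => rw [h.2]
    rw [Real.log_exp]
  rw [hlog]
  field_simp
  ring

/-- Without ties only the `N` largest gains reach the threshold. -/
theorem filter_threshold_subset (hg : Function.Injective g) (hN : 1 ≤ N) (c : ℝ) :
    ((Finset.Icc 1 n).filter fun i => max (threshold g N) c ≤ largest g i) ⊆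
      Finset.Icc 1 N := by
  intro i hi
  rw [Finset.mem_filter, Finset.mem_Icc] at hi
  rw [Finset.mem_Icc]
  refine ⟨hi.1.1, ?_⟩
  by_contra! hlt
  exact absurd ((le_max_left _ _).trans hi.2) (not_le.2 (largest_lt_largest hg hN hlt hi.1.2))

/-- Both levels spend the demand `R`, and dropping from the `N` scheduled slots those with
`ν g < 1` only increases `∑ log (ν g)`. -/
theorem IsWaterLevel.le_fullLevel (h : IsWaterLevel g N R ν) (hpos : ∀ t, 0 < g t)
    (hg : Function.Injective g) (hN : 1 ≤ N) (hNn : N ≤ n) : ν ≤ fullLevel g N R := by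
  have hν := h.pos
  have h1 := h.log_eq
  have h2 := log_fullLevel (g := g) (R := R) hN
  set S := (Finset.Icc 1 n).filter fun i => max (threshold g N) (1 / ν) ≤ largest g i with hS
  have hcard : (activeSlots g N ν).card = S.card :=
    (card_filter_largest g fun x => max (threshold g N) (1 / ν) ≤ x).symm
  have hsum : ∑ t ∈ activeSlots g N ν, Real.log (g t) = ∑ i ∈ S, Real.log (largest g i) :=
    (sum_filter_largest g (fun x => max (threshold g N) (1 / ν) ≤ x) Real.log).symm
  have hSN : S ⊆ Finset.Icc 1 N := filter_threshold_subset hg hN _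
  have hle : ∑ i ∈ Finset.Icc 1 N, (Real.log ν + Real.log (largest g i))
      ≤ ∑ i ∈ S, (Real.log ν + Real.log (largest g i)) := by
    rw [← Finset.sum_sdiff hSN]
    refine add_le_of_nonpos_left (Finset.sum_nonpos fun i hi => ?_)
    rw [Finset.mem_sdiff, Finset.mem_Icc, hS, Finset.mem_filter, Finset.mem_Icc] at hi
    have hin : i ≤ n := hi.1.2.trans hNn
    have hi0 := largest_pos hpos hi.1.1 hin
    have hlt : largest g i < 1 / ν := by
      by_contra! hge
      exact hi.2 ⟨⟨hi.1.1, hin⟩, max_le (largest_le_largest hi.1.1 hi.1.2 hNn) hge⟩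
    rw [← Real.log_mul hν.ne' hi0.ne']
    refine Real.log_nonpos (by positivity) ?_
    rw [lt_div_iff₀ hν] at hlt
    linarith
  rw [Finset.sum_add_distrib, Finset.sum_add_distrib, Finset.sum_const, Finset.sum_const,
    Nat.card_Icc, Nat.add_sub_cancel, nsmul_eq_mul, nsmul_eq_mul, ← hcard, ← hsum, h1] at hle
  have hN0 : (0 : ℝ) < N := by exact_mod_cast hN
  have hlog : Real.log ν ≤ Real.log (fullLevel g N R) := by
    refine le_of_mul_le_mul_left ?_ hN0
    linarith
  exact (Real.log_le_log_iff hν (fullLevel_pos g N R)).1 hlog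

theorem sum_slotPower (g : Fin n → ℝ) (N : ℕ) (ν : ℝ) :
    ∑ t, slotPower g N ν t = ∑ t ∈ activeSlots g N ν, (ν - 1 / g t) := by
  simp only [slotPower]
  rw [← Finset.sum_filter]
  congr 1
  ext t
  simp

theorem IsWaterLevel.transmitPower_mem_Icc (h : IsWaterLevel g N R ν) (hpos : ∀ t, 0 < g t) :
    transmitPower g N ν ∈ Set.Icc 0 ν := by
  have hν := h.pos
  have hslot : ∀ t, slotPower g N ν t ∈ Set.Icc 0 ν := by
    intro t
    rw [slotPower]
    split_ifs with ht
    · rw [activeSlots, Finset.mem_filter] at ht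
      have h1 : 1 / ν ≤ g t := (le_max_right _ _).trans ht.2
      have h2 : 1 / g t ≤ ν := by
        rw [div_le_iff₀ (hpos t)]
        rw [div_le_iff₀ hν] at h1
        linarith
      have h3 : 0 < 1 / g t := one_div_pos.2 (hpos t)
      exact ⟨by linarith, by linarith⟩
    · exact ⟨le_rfl, hν.le⟩
  obtain ⟨t₀, -⟩ := h.1
  have hn : (0 : ℝ) < n := by exact_mod_cast t₀.pos
  refine ⟨mul_nonneg (by positivity) (Finset.sum_nonneg fun t _ => (hslot t).1), ?_⟩
  have hsum : ∑ t, slotPower g N ν t ≤ n * ν := by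
    simpa using Finset.sum_le_card_nsmul Finset.univ _ ν fun t _ => (hslot t).2
  rw [transmitPower, one_div, ← div_eq_inv_mul, div_le_iff₀ hn]
  linarith

theorem sum_activeSlots_of_one_le (hν : 0 < ν) (hg : Function.Injective g)
    (hN : 1 ≤ N) (hNn : N ≤ n) (h1 : 1 ≤ ν * threshold g N) {M : Type*} [AddCommMonoid M]
    (ψ : ℝ → M) :
    ∑ t ∈ activeSlots g N ν, ψ (g t) = ∑ i ∈ Finset.Icc 1 N, ψ (largest g i) := by
  have hS : ((Finset.Icc 1 n).filter fun i => max (threshold g N) (1 / ν) ≤ largest g i)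
      = Finset.Icc 1 N := by
    refine (filter_threshold_subset hg hN _).antisymm fun i hi => ?_
    rw [Finset.mem_Icc] at hi
    refine Finset.mem_filter.2 ⟨Finset.mem_Icc.2 ⟨hi.1, hi.2.trans hNn⟩, max_le ?_ ?_⟩
    · exact largest_le_largest hi.1 hi.2 hNn
    · rw [div_le_iff₀ hν, mul_comm]
      exact h1.trans (mul_le_mul_of_nonneg_left (largest_le_largest hi.1 hi.2 hNn) hν.le)
  rw [← hS]
  exact (sum_filter_largest g (fun x => max (threshold g N) (1 / ν) ≤ x) ψ).symm

theorem card_activeSlots_of_one_le (hν : 0 < ν) (hg : Function.Injective g)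
    (hN : 1 ≤ N) (hNn : N ≤ n) (h1 : 1 ≤ ν * threshold g N) : (activeSlots g N ν).card = N := by
  simpa using sum_activeSlots_of_one_le hν hg hN hNn h1 fun _ => (1 : ℕ)

theorem IsWaterLevel.eq_fullLevel (h : IsWaterLevel g N R ν) (hg : Function.Injective g)
    (hN : 1 ≤ N) (hNn : N ≤ n) (h1 : 1 ≤ ν * threshold g N) : ν = fullLevel g N R := by
  have h2 := h.2
  rwa [card_activeSlots_of_one_le h.pos hg hN hNn h1,
    sum_activeSlots_of_one_le h.pos hg hN hNn h1 Real.log] at h2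

theorem IsWaterLevel.transmitPower_eq (h : IsWaterLevel g N R ν) (hg : Function.Injective g)
    (hN : 1 ≤ N) (hNn : N ≤ n) (h1 : 1 ≤ ν * threshold g N) :
    transmitPower g N ν = fullPower g N R := by
  rw [transmitPower, fullPower, sum_slotPower,
    sum_activeSlots_of_one_le h.pos hg hN hNn h1 fun x => ν - 1 / x, Finset.sum_sub_distrib,
    ← h.eq_fullLevel hg hN hNn h1]
  simp
  ring

end WaterFilling

/-! ### Mean-square convergence -/

section MeanSquare

variable {Ω : Type*} [MeasurableSpace Ω]

/-- Under the laws `Q k`, the variables `X k` are square integrable for large `k` and tend to the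
constant `m` in mean square. -/
def TendstoMeanSq (Q : ℕ → Measure Ω) (X : ℕ → Ω → ℝ) (m : ℝ) : Prop :=
  (∀ᶠ k in atTop, MemLp (X k) 2 (Q k)) ∧
    Tendsto (fun k => ∫ ω, (X k ω - m) ^ 2 ∂(Q k)) atTop (𝓝 0)

variable {Q : ℕ → Measure Ω} {X Y : ℕ → Ω → ℝ} {m m' : ℝ}

theorem integrable_sq_sub {μ : Measure Ω} [IsFiniteMeasure μ] {f : Ω → ℝ} (hf : MemLp f 2 μ)
    (c : ℝ) : Integrable (fun ω => (f ω - c) ^ 2) μ :=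
  (hf.sub (memLp_const c)).integrable_sq

theorem TendstoMeanSq.tendsto_measure (h : TendstoMeanSq Q X m)
    (hQ : ∀ᶠ k in atTop, IsProbabilityMeasure (Q k)) {ε : ℝ} (hε : 0 < ε) :
    Tendsto (fun k => (Q k).real {ω | ε ≤ |X k ω - m|}) atTop (𝓝 0) := by
  have hlim : Tendsto (fun k => (∫ ω, (X k ω - m) ^ 2 ∂(Q k)) / ε ^ 2) atTop (𝓝 0) := by
    simpa using h.2.div_const (ε ^ 2)
  refine tendsto_of_tendsto_of_tendsto_of_le_of_le' tendsto_const_nhds hlim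
    (Eventually.of_forall fun k => measureReal_nonneg) ?_
  filter_upwards [h.1, hQ] with k hk hQk
  rw [le_div_iff₀ (by positivity), mul_comm]
  have hset : {ω | ε ≤ |X k ω - m|} = {ω | ε ^ 2 ≤ (X k ω - m) ^ 2} := by
    ext ω
    simp only [Set.mem_ofPred_eq]
    rw [← sq_abs (X k ω - m), sq_le_sq₀ hε.le (abs_nonneg _)]
  rw [hset]
  exact mul_meas_ge_le_integral_of_nonneg (Eventually.of_forall fun ω => sq_nonneg _)
    (integrable_sq_sub hk m) _

theorem TendstoMeanSq.hasMeanLimitAndConcentrates (h : TendstoMeanSq Q X m)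
    (hQ : ∀ᶠ k in atTop, IsProbabilityMeasure (Q k)) : HasMeanLimitAndConcentrates Q X m := by
  refine ⟨h.1, ?_, ?_, fun ε hε => ?_⟩
  · have hsqrt : Tendsto (fun k => √(∫ ω, (X k ω - m) ^ 2 ∂(Q k))) atTop (𝓝 0) := by
      have := (Real.continuous_sqrt.tendsto 0).comp h.2
      rwa [Real.sqrt_zero] at this
    rw [tendsto_iff_norm_sub_tendsto_zero]
    refine squeeze_zero' (Eventually.of_forall fun k => norm_nonneg _) ?_ hsqrt
    filter_upwards [h.1, hQ] with k hk hQk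
    have hint := hk.integrable one_le_two
    have hsub : ∫ ω, X k ω ∂(Q k) - m = ∫ ω, (X k ω - m) ∂(Q k) := by
      rw [integral_sub hint (integrable_const m)]
      simp
    rw [hsub, Real.norm_eq_abs]
    refine Real.abs_le_sqrt ?_
    have hv := variance_nonneg (fun ω => X k ω - m) (Q k)
    rw [variance_eq_sub (show MemLp (fun ω => X k ω - m) 2 (Q k) from hk.sub (memLp_const m))] at hv
    simpa using hv
  · refine squeeze_zero' (Eventually.of_forall fun k => variance_nonneg _ _) ?_ h.2
    filter_upwards [h.1, hQ] with k hk hQk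
    rw [← variance_sub_const hk.aestronglyMeasurable m]
    exact variance_le_expectation_sq (hk.aestronglyMeasurable.sub aestronglyMeasurable_const)
  · have := (ENNReal.tendsto_ofReal (h.tendsto_measure hQ hε))
    rw [ENNReal.ofReal_zero] at this
    refine this.congr' ?_
    filter_upwards [hQ] with k hQk
    rw [ofReal_measureReal]

theorem TendstoMeanSq.of_sq_le {B : ℕ → Ω → ℝ}
    (hQ : ∀ᶠ k in atTop, IsProbabilityMeasure (Q k))
    (hX : ∀ᶠ k in atTop, AEStronglyMeasurable (X k) (Q k))
    (hB : ∀ᶠ k in atTop, Integrable (B k) (Q k))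
    (hle : ∀ᶠ k in atTop, ∀ᵐ ω ∂(Q k), (X k ω - m) ^ 2 ≤ B k ω)
    (hlim : Tendsto (fun k => ∫ ω, B k ω ∂(Q k)) atTop (𝓝 0)) : TendstoMeanSq Q X m := by
  have hmem : ∀ᶠ k in atTop, MemLp (X k) 2 (Q k) := by
    filter_upwards [hQ, hX, hB, hle] with k hQk hXk hBk hk
    have hm : AEStronglyMeasurable (fun ω => X k ω - m) (Q k) :=
      hXk.sub aestronglyMeasurable_const
    have h2 : MemLp (fun ω => X k ω - m) 2 (Q k) := by
      rw [memLp_two_iff_integrable_sq hm]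
      refine hBk.mono' (hm.pow 2) ?_
      filter_upwards [hk] with ω hω
      rwa [Real.norm_eq_abs, abs_of_nonneg (sq_nonneg _)]
    refine (memLp_congr_ae (Eventually.of_forall fun ω => ?_)).1 (h2.add (memLp_const m))
    simp
  refine ⟨hmem, squeeze_zero' (Eventually.of_forall fun k => integral_nonneg fun ω => sq_nonneg _)
    ?_ hlim⟩
  filter_upwards [hQ, hmem, hB, hle] with k hQk hXk hBk hk
  exact integral_mono_ae (integrable_sq_sub hXk m) hBk hk

variable {P : Measure Ω} [IsProbabilityMeasure P]

theorem TendstoMeanSq.const_mul_sub (hX : TendstoMeanSq (fun _ => P) X m)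
    (hY : TendstoMeanSq (fun _ => P) Y m') {c : ℕ → ℝ} {c₀ : ℝ} (hc : Tendsto c atTop (𝓝 c₀)) :
    TendstoMeanSq (fun _ => P) (fun k ω => c k * X k ω - Y k ω) (c₀ * m - m') := by
  have hP : ∀ᶠ k in (atTop : Filter ℕ), IsProbabilityMeasure ((fun _ => P) k) :=
    Eventually.of_forall fun _ => inferInstance
  refine TendstoMeanSq.of_sq_le (B := fun k ω => 3 * c k ^ 2 * (X k ω - m) ^ 2
    + (3 * (Y k ω - m') ^ 2 + 3 * ((c k - c₀) * m) ^ 2)) hP ?_ ?_ ?_ ?_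
  · filter_upwards [hX.1, hY.1] with k h1 h2
    exact (h1.aestronglyMeasurable.const_mul _).sub h2.aestronglyMeasurable
  · filter_upwards [hX.1, hY.1] with k h1 h2
    exact ((integrable_sq_sub h1 m).const_mul _).add
      (((integrable_sq_sub h2 m').const_mul 3).add (integrable_const _))
  · refine Eventually.of_forall fun k => Eventually.of_forall fun ω => ?_
    nlinarith [sq_nonneg (c k * (X k ω - m) + (Y k ω - m')),
      sq_nonneg (c k * (X k ω - m) - (c k - c₀) * m), sq_nonneg ((Y k ω - m') + (c k - c₀) * m)]
  · have hlim : Tendsto (fun k => 3 * c k ^ 2 * (∫ ω, (X k ω - m) ^ 2 ∂P)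
        + (3 * (∫ ω, (Y k ω - m') ^ 2 ∂P) + 3 * ((c k - c₀) * m) ^ 2)) atTop (𝓝 0) := by
      have := (((hc.pow 2).const_mul 3).mul hX.2).add
        ((hY.2.const_mul 3).add ((((hc.sub_const c₀).mul_const m).pow 2).const_mul 3))
      simpa using this
    refine hlim.congr' ?_
    filter_upwards [hX.1, hY.1] with k h1 h2
    have i1 := (integrable_sq_sub h1 m).const_mul (3 * c k ^ 2)
    have i2 := (integrable_sq_sub h2 m').const_mul 3
    have i3 : Integrable (fun ω => 3 * (Y k ω - m') ^ 2 + 3 * ((c k - c₀) * m) ^ 2) P :=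
      i2.add (integrable_const _)
    rw [integral_add i1 i3, integral_add i2 (integrable_const _),
      integral_const_mul, integral_const_mul]
    simp

theorem TendstoMeanSq.add (hX : TendstoMeanSq (fun _ => P) X m)
    (hY : TendstoMeanSq (fun _ => P) Y m') :
    TendstoMeanSq (fun _ => P) (fun k ω => X k ω + Y k ω) (m + m') := by
  have hzero : TendstoMeanSq (fun _ => P) (fun _ _ => 0) 0 :=
    ⟨Eventually.of_forall fun _ => memLp_const 0, by simp⟩
  have hneg := hzero.const_mul_sub hY (tendsto_const_nhds (x := (1 : ℝ)))
  simpa using hX.const_mul_sub hneg (tendsto_const_nhds (x := (1 : ℝ)))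

theorem tendsto_zero_of_forall_eventually_le {u : ℕ → ℝ} (h0 : ∀ k, 0 ≤ u k)
    (h : ∀ ε > 0, ∀ᶠ k in atTop, u k ≤ ε) : Tendsto u atTop (𝓝 0) := by
  rw [Metric.tendsto_nhds]
  intro ε hε
  filter_upwards [h (ε / 2) (by positivity)] with k hk
  rw [Real.dist_eq, sub_zero, abs_of_nonneg (h0 k)]
  linarith

theorem mul_le_weighted_sq {δ : ℝ} (hδ : 0 < δ) (a b : ℝ) :
    a * b ≤ δ * b ^ 2 + a ^ 2 / (4 * δ) := by
  have : δ * b ^ 2 + a ^ 2 / (4 * δ) - a * b = (2 * δ * b - a) ^ 2 / (4 * δ) := by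
    field_simp
    ring
  have h2 : 0 ≤ (2 * δ * b - a) ^ 2 / (4 * δ) := by positivity
  linarith

/-- A product of a bounded factor that vanishes in mean square with a factor of bounded fourth
moment vanishes in mean square. -/
theorem TendstoMeanSq.of_abs_le_mul {D V : ℕ → Ω → ℝ} {K : ℝ}
    (hX : ∀ᶠ k in atTop, AEStronglyMeasurable (X k) P)
    (hD : TendstoMeanSq (fun _ => P) D 0) (hD1 : ∀ᶠ k in atTop, ∀ ω, |D k ω| ≤ 1)
    (hV : ∀ᶠ k in atTop, Integrable (fun ω => V k ω ^ 4) P ∧ ∫ ω, V k ω ^ 4 ∂P ≤ K)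
    (hle : ∀ᶠ k in atTop, ∀ᵐ ω ∂P, |X k ω| ≤ |D k ω| * V k ω) :
    TendstoMeanSq (fun _ => P) X 0 := by
  have hbound : ∀ δ > 0, ∀ᶠ k in atTop, ∀ᵐ ω ∂P,
      (X k ω - 0) ^ 2 ≤ δ * V k ω ^ 4 + D k ω ^ 2 / (4 * δ) := by
    intro δ hδ
    filter_upwards [hD1, hle] with k h1 h2
    filter_upwards [h2] with ω hω
    have hsq : X k ω ^ 2 ≤ D k ω ^ 2 * V k ω ^ 2 := by
      rw [← sq_abs (X k ω), ← sq_abs (D k ω), ← mul_pow]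
      exact pow_le_pow_left₀ (abs_nonneg _) hω 2
    have hw := mul_le_weighted_sq hδ (D k ω ^ 2) (V k ω ^ 2)
    have hD4 : (D k ω ^ 2) ^ 2 ≤ D k ω ^ 2 := by
      have : D k ω ^ 2 ≤ 1 := by rw [← sq_abs]; exact pow_le_one₀ (abs_nonneg _) (h1 ω)
      nlinarith [sq_nonneg (D k ω)]
    have hD5 : (D k ω ^ 2) ^ 2 / (4 * δ) ≤ D k ω ^ 2 / (4 * δ) := by gcongr
    rw [sub_zero]
    calc X k ω ^ 2 ≤ _ := hsq
      _ ≤ _ := hw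
      _ ≤ _ := by rw [← pow_mul]; linarith
  have hint : ∀ δ > 0, ∀ᶠ k in atTop,
      Integrable (fun ω => δ * V k ω ^ 4 + D k ω ^ 2 / (4 * δ)) P := by
    intro δ hδ
    filter_upwards [hV, hD.1] with k h1 h2
    exact (h1.1.const_mul δ).add (h2.integrable_sq.div_const _)
  have hmem : ∀ᶠ k in atTop, MemLp (X k) 2 P := by
    filter_upwards [hX, hbound 1 one_pos, hint 1 one_pos] with k h1 h2 h3
    rw [memLp_two_iff_integrable_sq h1]
    refine h3.mono' (h1.pow 2) ?_
    filter_upwards [h2] with ω hω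
    rw [sub_zero] at hω
    rwa [Real.norm_eq_abs, abs_of_nonneg (sq_nonneg _)]
  refine ⟨hmem, tendsto_zero_of_forall_eventually_le
    (fun k => integral_nonneg fun ω => sq_nonneg _) fun ε hε => ?_⟩
  -- With this weight the fourth-moment term is at most `ε / 2`.
  set δ := ε / (2 * (|K| + 1)) with hδdef
  have hδ : 0 < δ := by positivity
  have hD0 : ∀ᶠ k in atTop, ∫ ω, (D k ω - 0) ^ 2 ∂P < 2 * δ * ε :=
    hD.2.eventually_lt_const (by positivity)
  filter_upwards [hbound δ hδ, hint δ hδ, hmem, hV, hD.1, hD0] with k h1 h2 h3 h4 h5 h6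
  have h7 := integral_mono_ae (integrable_sq_sub h3 0) h2 h1
  rw [integral_add (h4.1.const_mul δ) (h5.integrable_sq.div_const _), integral_const_mul,
    integral_div] at h7
  simp only [sub_zero] at h6 h7 ⊢
  have h8 : δ * ∫ ω, V k ω ^ 4 ∂P ≤ ε / 2 := by
    have hK : ∫ ω, V k ω ^ 4 ∂P ≤ |K| + 1 := by linarith [h4.2, le_abs_self K]
    calc δ * ∫ ω, V k ω ^ 4 ∂P ≤ δ * (|K| + 1) := by gcongr
      _ = ε / 2 := by rw [hδdef]; field_simp
  have h9 : (∫ ω, D k ω ^ 2 ∂P) / (4 * δ) ≤ ε / 2 := by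
    rw [div_le_iff₀ (by positivity)]
    linarith
  linarith

/-- Convergence in probability together with bounded fourth moments gives mean-square
convergence. -/
theorem TendstoMeanSq.of_tendsto_measure {K : ℝ}
    (hX : ∀ᶠ k in atTop, AEMeasurable (X k) P)
    (hK : ∀ᶠ k in atTop, Integrable (fun ω => X k ω ^ 4) P ∧ ∫ ω, X k ω ^ 4 ∂P ≤ K)
    (hlim : ∀ ε > 0, Tendsto (fun k => P.real {ω | ε ≤ |X k ω - m|}) atTop (𝓝 0)) :
    TendstoMeanSq (fun _ => P) X m := by
  set K' := 8 * K + 8 * m ^ 4 with hK'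
  have h4 : ∀ᶠ k in atTop, Integrable (fun ω => (X k ω - m) ^ 4) P ∧
      ∫ ω, (X k ω - m) ^ 4 ∂P ≤ K' := by
    filter_upwards [hX, hK] with k h1 h2
    have hle : ∀ ω, (X k ω - m) ^ 4 ≤ 8 * X k ω ^ 4 + 8 * m ^ 4 := fun ω => by
      nlinarith [sq_nonneg (X k ω ^ 2 - m ^ 2), sq_nonneg (X k ω + m), sq_nonneg (X k ω - m),
        sq_nonneg (X k ω * m), sq_nonneg ((X k ω + m) ^ 2), sq_nonneg (X k ω ^ 2 + m ^ 2),
        mul_nonneg (sq_nonneg (X k ω + m)) (sq_nonneg (X k ω + m)),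
        mul_nonneg (sq_nonneg (X k ω - m)) (sq_nonneg (X k ω + m))]
    have hi : Integrable (fun ω => 8 * X k ω ^ 4 + 8 * m ^ 4) P :=
      (h2.1.const_mul 8).add (integrable_const _)
    have hi' : Integrable (fun ω => (X k ω - m) ^ 4) P := by
      refine hi.mono' ((h1.sub_const m).pow_const 4).aestronglyMeasurable ?_
      refine Eventually.of_forall fun ω => ?_
      rw [Real.norm_eq_abs, abs_of_nonneg (by positivity)]
      exact hle ω
    refine ⟨hi', (integral_mono hi' hi hle).trans ?_⟩
    rw [integral_add (h2.1.const_mul 8) (integrable_const _), integral_const_mul]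
    simp only [integral_const, probReal_univ, one_smul]
    rw [hK']
    linarith [h2.2]
  have hmem : ∀ᶠ k in atTop, MemLp (X k) 2 P := by
    filter_upwards [hX, hK] with k h1 h2
    rw [memLp_two_iff_integrable_sq h1.aestronglyMeasurable]
    refine (h2.1.add (integrable_const 1)).mono' (h1.pow_const 2).aestronglyMeasurable ?_
    refine Eventually.of_forall fun ω => ?_
    rw [Real.norm_eq_abs, abs_of_nonneg (by positivity)]
    simp only [Pi.add_apply]
    nlinarith [sq_nonneg (X k ω ^ 2 - 1), sq_nonneg (X k ω)]
  refine ⟨hmem, tendsto_zero_of_forall_eventually_le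
    (fun k => integral_nonneg fun ω => sq_nonneg _) fun ε hε => ?_⟩
  -- `ε` is split between `|X - m| < η`, the fourth moment, and the probability of `|X - m| ≥ η`.
  set δ := ε / (3 * (|K'| + 1)) with hδdef
  have hδ : 0 < δ := by positivity
  set η := √(ε / 3) with hη
  have hη0 : 0 < η := Real.sqrt_pos.2 (by positivity)
  have hη2 : η ^ 2 = ε / 3 := Real.sq_sqrt (by positivity)
  have hp : ∀ᶠ k in atTop, P.real {ω | η ≤ |X k ω - m|} < 4 * δ * (ε / 3) :=
    (hlim η hη0).eventually_lt_const (by positivity)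
  filter_upwards [hX, h4, hmem, hp] with k h1 h2 h3 h5
  set A := {ω | η ≤ |X k ω - m|} with hA
  have hAm : NullMeasurableSet A P :=
    nullMeasurableSet_le aemeasurable_const
      (continuous_abs.measurable.comp_aemeasurable (h1.sub_const m))
  have hAi : Integrable (A.indicator fun _ => (1 : ℝ)) P :=
    (integrable_const (1 : ℝ)).indicator₀ hAm
  have hle : ∀ ω, (X k ω - m) ^ 2 ≤
      δ * (X k ω - m) ^ 4 + (ε / 3 + A.indicator (fun _ => (1 : ℝ)) ω / (4 * δ)) := by
    intro ω
    have h0 : 0 ≤ δ * (X k ω - m) ^ 4 := by positivity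
    by_cases hω : ω ∈ A
    · have hw := mul_le_weighted_sq hδ 1 ((X k ω - m) ^ 2)
      rw [Set.indicator_of_mem hω]
      rw [one_mul, ← pow_mul, one_pow] at hw
      linarith
    · rw [Set.indicator_of_notMem hω, zero_div, add_zero, ← hη2]
      rw [hA, Set.mem_ofPred_eq, not_le] at hω
      have := pow_le_pow_left₀ (abs_nonneg _) hω.le 2
      rw [sq_abs] at this
      linarith
  have hi : Integrable (fun ω => ε / 3 + A.indicator (fun _ => (1 : ℝ)) ω / (4 * δ)) P :=
    (integrable_const _).add (hAi.div_const _)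
  have h7 := integral_mono (integrable_sq_sub h3 m) ((h2.1.const_mul δ).add hi) hle
  simp only [Pi.add_apply] at h7
  rw [integral_add (h2.1.const_mul δ) hi, integral_add (integrable_const _) (hAi.div_const _),
    integral_const_mul, integral_div (4 * δ), integral_indicator₀ hAm] at h7
  simp only [integral_const, measureReal_restrict_apply_univ, probReal_univ, smul_eq_mul, mul_one,
    one_mul] at h7
  have h8 : δ * ∫ ω, (X k ω - m) ^ 4 ∂P ≤ ε / 3 := by
    have hK : ∫ ω, (X k ω - m) ^ 4 ∂P ≤ |K'| + 1 := by linarith [h2.2, le_abs_self K']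
    calc δ * ∫ ω, (X k ω - m) ^ 4 ∂P ≤ δ * (|K'| + 1) := by gcongr
      _ = ε / 3 := by rw [hδdef]; field_simp
  have h9 : P.real A / (4 * δ) ≤ ε / 3 := by
    rw [div_le_iff₀ (by positivity)]
    linarith
  linarith

end MeanSquare

/-! ### Independent samples with a given mean law -/

section Sample

variable {Ω : Type*} [MeasurableSpace Ω] {P : Measure Ω} {n : ℕ} {X : Fin n → Ω → ℝ}
  {μ : Measure ℝ}

/-- The variables `X t` are independent, and the mean of their laws is `μ`. The laws themselves
may differ, so that both the block-fading and the i.i.d. gains are covered. -/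
structure IsIndepSample (P : Measure Ω) {n : ℕ} (X : Fin n → Ω → ℝ) (μ : Measure ℝ) : Prop where
  aemeasurable : ∀ t, AEMeasurable (X t) P
  indep : iIndepFun X P
  sum_map : ∑ t, P.map (X t) = (n : ENNReal) • μ

namespace IsIndepSample

theorem map_absolutelyContinuous (h : IsIndepSample P X μ) (t : Fin n) : P.map (X t) ≪ μ := by
  have h1 : P.map (X t) ≤ ∑ t, P.map (X t) := Finset.single_le_sum
    (f := fun t => P.map (X t)) (fun _ _ => Measure.zero_le _) (Finset.mem_univ t)
  rw [h.sum_map] at h1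
  exact h1.absolutelyContinuous.trans (Measure.smul_absolutelyContinuous)

theorem ae_comp (h : IsIndepSample P X μ) {p : ℝ → Prop} (hp : ∀ᵐ x ∂μ, p x) :
    ∀ᵐ ω ∂P, ∀ t, p (X t ω) :=
  ae_all_iff.2 fun t =>
    ae_of_ae_map (h.aemeasurable t) ((h.map_absolutelyContinuous t).ae_le hp)

theorem integrable_map (h : IsIndepSample P X μ) {ψ : ℝ → ℝ} (hψ : Integrable ψ μ) (t : Fin n) :
    Integrable ψ (P.map (X t)) := by
  have h1 : Integrable ψ (∑ t, P.map (X t)) := by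
    rw [h.sum_map]
    exact hψ.smul_measure (ENNReal.natCast_ne_top n)
  exact integrable_finsetSum_measure.1 h1 t (Finset.mem_univ t)

theorem integrable_comp (h : IsIndepSample P X μ) {ψ : ℝ → ℝ} (hψ : Integrable ψ μ) (t : Fin n) :
    Integrable (fun ω => ψ (X t ω)) P :=
  (h.integrable_map hψ t).comp_aemeasurable (h.aemeasurable t)

theorem sum_integral_comp (h : IsIndepSample P X μ) {ψ : ℝ → ℝ} (hψ : Integrable ψ μ) :
    ∑ t, ∫ ω, ψ (X t ω) ∂P = n * ∫ x, ψ x ∂μ := by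
  have h1 : ∫ x, ψ x ∂(∑ t, P.map (X t)) = n * ∫ x, ψ x ∂μ := by
    rw [h.sum_map, integral_smul_measure]
    simp
  rw [← h1, integral_finsetSum_measure fun t _ => h.integrable_map hψ t]
  exact Finset.sum_congr rfl fun t _ =>
    (integral_map (h.aemeasurable t) (h.integrable_map hψ t).aestronglyMeasurable).symm

theorem memLp_comp (h : IsIndepSample P X μ) {ψ : ℝ → ℝ} (hψm : Measurable ψ)
    (hψ : MemLp ψ 2 μ) (t : Fin n) : MemLp (fun ω => ψ (X t ω)) 2 P := by
  have hm : AEStronglyMeasurable (fun ω => ψ (X t ω)) P :=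
    (hψm.comp_aemeasurable (h.aemeasurable t)).aestronglyMeasurable
  rw [memLp_two_iff_integrable_sq hm]
  exact h.integrable_comp hψ.integrable_sq t

theorem memLp_average (h : IsIndepSample P X μ) {ψ : ℝ → ℝ} (hψm : Measurable ψ)
    (hψ : MemLp ψ 2 μ) : MemLp (fun ω => 1 / (n : ℝ) * ∑ t, ψ (X t ω)) 2 P :=
  (memLp_finsetSum Finset.univ fun t _ => h.memLp_comp hψm hψ t).const_mul _

/-- The variances of independent variables add up, and each is at most the second moment; the
second moments are averaged by `sum_map`. -/
theorem integral_sq_average_sub_le (h : IsIndepSample P X μ) [IsFiniteMeasure μ] (hn : 0 < n)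
    {ψ : ℝ → ℝ} (hψm : Measurable ψ) (hψ : MemLp ψ 2 μ) :
    ∫ ω, (1 / (n : ℝ) * ∑ t, ψ (X t ω) - ∫ x, ψ x ∂μ) ^ 2 ∂P
      ≤ 1 / (n : ℝ) * ∫ x, ψ x ^ 2 ∂μ := by
  have hP : IsProbabilityMeasure P := h.indep.isProbabilityMeasure
  have hn0 : (n : ℝ) ≠ 0 := by positivity
  have hmem := h.memLp_average hψm hψ
  have hint := hψ.integrable one_le_two
  have hmean : ∫ ω, 1 / (n : ℝ) * ∑ t, ψ (X t ω) ∂P = ∫ x, ψ x ∂μ := by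
    rw [integral_const_mul, integral_finsetSum _ fun t _ => h.integrable_comp hint t,
      h.sum_integral_comp hint]
    field_simp
  rw [← hmean, ← variance_eq_integral hmem.aemeasurable, variance_const_mul]
  have hsum : variance (fun ω => ∑ t, ψ (X t ω)) P = ∑ t, variance (fun ω => ψ (X t ω)) P := by
    have := IndepFun.variance_sum (μ := P) (X := fun t ω => ψ (X t ω)) (s := Finset.univ)
      (fun t _ => h.memLp_comp hψm hψ t)
      (fun i _ j _ hij => (h.indep.indepFun hij).comp hψm hψm)
    rw [← this]
    congr 1
    ext ω
    simp
  have hle : ∑ t, variance (fun ω => ψ (X t ω)) P ≤ n * ∫ x, ψ x ^ 2 ∂μ := by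
    rw [← h.sum_integral_comp (ψ := fun x => ψ x ^ 2) hψ.integrable_sq]
    exact Finset.sum_le_sum fun t _ =>
      variance_le_expectation_sq (h.memLp_comp hψm hψ t).aestronglyMeasurable
  rw [hsum]
  calc (1 / (n : ℝ)) ^ 2 * ∑ t, variance (fun ω => ψ (X t ω)) P
      ≤ (1 / (n : ℝ)) ^ 2 * (n * ∫ x, ψ x ^ 2 ∂μ) := by gcongr
    _ = 1 / (n : ℝ) * ∫ x, ψ x ^ 2 ∂μ := by field_simp

theorem ae_injective (h : IsIndepSample P X μ) [NullSingletonClass μ] :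
    ∀ᵐ ω ∂P, Function.Injective fun t => X t ω := by
  have hP : IsProbabilityMeasure P := h.indep.isProbabilityMeasure
  -- The joint law of two gains is a product of atomless laws, which does not charge the diagonal.
  have hne : ∀ s t : Fin n, s ≠ t → ∀ᵐ ω ∂P, X s ω ≠ X t ω := by
    intro s t hst
    have hlaw := (indepFun_iff_map_prod_eq_prod_map_map (h.aemeasurable s)
      (h.aemeasurable t)).1 (h.indep.indepFun hst)
    have hpair : AEMeasurable (fun ω => (X s ω, X t ω)) P :=
      (h.aemeasurable s).prodMk (h.aemeasurable t)
    have hprob : IsProbabilityMeasure (P.map (X t)) :=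
      Measure.isProbabilityMeasure_map (h.aemeasurable t)
    have hdiag : ∀ᵐ z ∂(P.map fun ω => (X s ω, X t ω)), z.1 ≠ z.2 := by
      have hm : MeasurableSet {z : ℝ × ℝ | z.1 ≠ z.2} :=
        (measurableSet_eq_fun measurable_fst measurable_snd).compl
      rw [hlaw, Measure.ae_prod_iff_ae_ae hm]
      refine Eventually.of_forall fun x => ?_
      rw [ae_iff]
      simp only [ne_eq, not_not]
      refine h.map_absolutelyContinuous t ?_
      have : {y | x = y} = {x} := by ext; simp [eq_comm]
      rw [this]
      exact measure_singleton x
    exact ae_of_ae_map hpair hdiag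
  have hall : ∀ᵐ ω ∂P, ∀ s t : Fin n, s ≠ t → X s ω ≠ X t ω := by
    rw [ae_all_iff]
    intro s
    rw [ae_all_iff]
    intro t
    by_cases hst : s = t
    · exact Eventually.of_forall fun ω h' => absurd hst h'
    · filter_upwards [hne s t hst] with ω hω _ using hω
  filter_upwards [hall] with ω hω s t hst
  by_contra h'
  exact hω s t h' hst

/-- Convexity of `exp` gives `exp (s y) ≤ 1 + 2 s exp (y / 2)` for `s ≤ 1 / 2`, and the factor
`1 + 2 s M` of the product over the sample is at most `exp (2 s M)`. -/
theorem exp_moment_le (h : IsIndepSample P X μ) {ψ : ℝ → ℝ} (hψm : Measurable ψ)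
    (hψ : Integrable (fun x => Real.exp (1 / 2 * ψ x)) μ) {s : ℝ} (hs0 : 0 ≤ s)
    (hs : s ≤ 1 / 2) :
    Integrable (fun ω => Real.exp (s * ∑ t, ψ (X t ω))) P ∧
      ∫ ω, Real.exp (s * ∑ t, ψ (X t ω)) ∂P
        ≤ Real.exp (2 * s * (n * ∫ x, Real.exp (1 / 2 * ψ x) ∂μ)) := by
  have hP : IsProbabilityMeasure P := h.indep.isProbabilityMeasure
  have hconv : ∀ y : ℝ, Real.exp (s * y) ≤ 1 + 2 * s * Real.exp (1 / 2 * y) := by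
    intro y
    have := convexOn_exp.2 (Set.mem_univ (0 : ℝ)) (Set.mem_univ (1 / 2 * y))
      (show (0 : ℝ) ≤ 1 - 2 * s by linarith) (show (0 : ℝ) ≤ 2 * s by linarith) (by ring)
    simp only [smul_eq_mul, mul_zero, zero_add, Real.exp_zero, mul_one] at this
    rw [show 2 * s * (1 / 2 * y) = s * y by ring] at this
    linarith
  have hmeas : ∀ t, AEMeasurable (fun ω => ψ (X t ω)) P := fun t =>
    hψm.comp_aemeasurable (h.aemeasurable t)
  have hexp : ∀ t, Integrable (fun ω => Real.exp (1 / 2 * ψ (X t ω))) P :=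
    h.integrable_comp hψ
  have hdom : ∀ t, Integrable (fun ω => 1 + 2 * s * Real.exp (1 / 2 * ψ (X t ω))) P :=
    fun t => (integrable_const _).add ((hexp t).const_mul _)
  have hint : ∀ t, Integrable (fun ω => Real.exp (s * ψ (X t ω))) P := fun t => by
    refine (hdom t).mono' ((hmeas t).const_mul s).exp.aestronglyMeasurable ?_
    refine Eventually.of_forall fun ω => ?_
    rw [Real.norm_eq_abs, Real.abs_exp]
    exact hconv _
  have hmgf : ∀ t, mgf (fun ω => ψ (X t ω)) P s
      ≤ Real.exp (2 * s * ∫ ω, Real.exp (1 / 2 * ψ (X t ω)) ∂P) := fun t => by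
    refine (integral_mono (hint t) (hdom t) fun ω => hconv _).trans ?_
    rw [integral_add (integrable_const _) ((hexp t).const_mul _), integral_const_mul]
    simp only [integral_const, probReal_univ, one_smul]
    rw [add_comm]
    exact Real.add_one_le_exp _
  have hind : iIndepFun (fun t ω => ψ (X t ω)) P := h.indep.comp (fun _ => ψ) fun _ => hψm
  have hprod := hind.mgf_sum₀ hmeas Finset.univ (t := s)
  have hfun : (fun ω => Real.exp (s * (∑ t, fun ω => ψ (X t ω)) ω))
      = fun ω => Real.exp (s * ∑ t, ψ (X t ω)) := by
    ext ω
    simp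
  constructor
  · have hpos : 0 < mgf (∑ t, fun ω => ψ (X t ω)) P s := by
      rw [hprod]
      exact Finset.prod_pos fun t _ => mgf_pos (hint t)
    rw [← hfun]
    exact mgf_pos_iff.1 hpos
  · rw [← hfun]
    change mgf (∑ t, fun ω => ψ (X t ω)) P s ≤ _
    rw [hprod, ← h.sum_integral_comp hψ, Finset.mul_sum, Real.exp_sum]
    exact Finset.prod_le_prod (fun t _ => mgf_nonneg) fun t _ => hmgf t

end IsIndepSample

end Sample

/-! ### Limits of sums over the largest gains -/

section Asymptotics

variable {Ω : Type*} [MeasurableSpace Ω] {P : Measure Ω}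

/-- The regularity of the mean law of the gains on which the limit theorems rest: it is an
atomless probability measure on `(0, ∞)`, with finite moments of orders `1 / 2` and `-1 / 2`. -/
structure IsRegularGainLaw (μ : Measure ℝ) : Prop where
  isProbabilityMeasure : IsProbabilityMeasure μ
  nullSingletonClass : NullSingletonClass μ
  ae_pos : ∀ᵐ x ∂μ, 0 < x
  integrable_exp : Integrable (fun x => Real.exp (1 / 2 * |Real.log x|)) μ

theorem IsRegularGainLaw.memLp_log {μ : Measure ℝ} (hμ : IsRegularGainLaw μ) :
    MemLp Real.log 2 μ := by
  rw [memLp_two_iff_integrable_sq Real.measurable_log.aestronglyMeasurable]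
  refine (hμ.integrable_exp.const_mul 8).mono'
    (Real.measurable_log.pow_const 2).aestronglyMeasurable (Eventually.of_forall fun x => ?_)
  have h0 : 0 ≤ 1 / 2 * |Real.log x| := by positivity
  have := Real.quadratic_le_exp_of_nonneg h0
  rw [Real.norm_eq_abs, abs_of_nonneg (sq_nonneg _), ← sq_abs]
  nlinarith

/-- A common bound for a sample: `exp ((1 / (c n)) ∑ |log g|)` controls the threshold and its
inverse as soon as at least `c n` gains lie on either side of the threshold. -/
def logSpread {n : ℕ} (c : ℝ) (g : Fin n → ℝ) : ℝ :=
  Real.exp (1 / (c * n) * ∑ t, |Real.log (g t)|)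

theorem one_le_logSpread {n : ℕ} {c : ℝ} (hc : 0 ≤ c) (g : Fin n → ℝ) : 1 ≤ logSpread c g :=
  Real.one_le_exp (mul_nonneg (by positivity) (Finset.sum_nonneg fun _ _ => abs_nonneg _))

theorem exp_abs_log_largest_le {n N : ℕ} {g : Fin n → ℝ} (hg : ∀ t, 0 < g t) {c : ℝ}
    (hc : 0 < c * n) (hN : c * n ≤ N) (hNn : c * n ≤ n - N) :
    Real.exp |Real.log (largest g N)| ≤ logSpread c g := by
  have h1 : (0 : ℝ) < N := hc.trans_le hN
  have h2 : (0 : ℝ) < n - N := hc.trans_le hNn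
  have h3 : N < n := by
    have : (N : ℝ) < n := by linarith
    exact_mod_cast this
  have h4 : 1 ≤ N := by exact_mod_cast h1
  rw [logSpread, Real.exp_le_exp]
  refine (abs_log_largest_le hg (m := min N (n - N)) h4 h3.le (by omega) (min_le_left _ _)
    (by omega)).trans ?_
  refine mul_le_mul_of_nonneg_right ?_ (Finset.sum_nonneg fun _ _ => abs_nonneg _)
  refine one_div_le_one_div_of_le hc ?_
  rw [Nat.cast_min, Nat.cast_sub h3.le]
  exact le_min hN hNn

variable {n N : ℕ → ℕ} {G : (k : ℕ) → Fin (n k) → Ω → ℝ} {μ : Measure ℝ} {κ : ℝ}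

theorem exists_eventually_mul_le (hn : Tendsto n atTop atTop) (hκ0 : 0 < κ) (hκ1 : κ < 1)
    (hN : Tendsto (fun k => (N k : ℝ) / n k) atTop (𝓝 κ)) :
    ∃ c : ℝ, 0 < c ∧ ∀ᶠ k in atTop,
      8 ≤ c * n k ∧ c * n k ≤ N k ∧ c * n k ≤ n k - N k := by
  have hc : 0 < min κ (1 - κ) / 2 := by
    have := lt_min hκ0 (sub_pos.2 hκ1)
    positivity
  refine ⟨min κ (1 - κ) / 2, hc, ?_⟩
  set c := min κ (1 - κ) / 2 with hcdef
  have h1 : c < κ := by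
    have := min_le_left κ (1 - κ)
    linarith
  have h2 : κ < 1 - c := by
    have := min_le_right κ (1 - κ)
    linarith
  -- `8 ≤ c n` makes the exponent `4 / (c n)` of the fourth moment at most `1 / 2`.
  have hn8 : Tendsto (fun k => c * (n k : ℝ)) atTop atTop :=
    (tendsto_natCast_atTop_atTop.comp hn).const_mul_atTop hc
  filter_upwards [hN.eventually_const_lt h1, hN.eventually_lt_const h2,
    hn8.eventually_ge_atTop 8] with k hk1 hk2 hk3
  have hn0 : (0 : ℝ) < n k := by
    by_contra! hneg
    nlinarith
  rw [lt_div_iff₀ hn0] at hk1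
  rw [div_lt_iff₀ hn0] at hk2
  exact ⟨hk3, hk1.le, by linarith⟩

theorem logSpread_fourth_moment (hμ : IsRegularGainLaw μ) (hG : ∀ k, IsIndepSample P (G k) μ)
    {c : ℝ} (hc : 0 < c) (hcn : ∀ᶠ k in atTop, 8 ≤ c * n k) :
    ∃ K, ∀ᶠ k in atTop, Integrable (fun ω => logSpread c (fun t => G k t ω) ^ 4) P ∧
      ∫ ω, logSpread c (fun t => G k t ω) ^ 4 ∂P ≤ K := by
  set M := ∫ x, Real.exp (1 / 2 * |Real.log x|) ∂μ with hM
  refine ⟨Real.exp (8 * M / c), ?_⟩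
  filter_upwards [hcn] with k hk
  have hn0 : (n k : ℝ) ≠ 0 := by
    intro h0
    rw [h0] at hk
    linarith
  have hs0 : 0 ≤ 4 / (c * n k) := by positivity
  have hs : 4 / (c * n k) ≤ 1 / 2 := by
    rw [div_le_iff₀ (by linarith)]
    linarith
  have h := (hG k).exp_moment_le (ψ := fun x => |Real.log x|)
    (continuous_abs.measurable.comp Real.measurable_log) hμ.integrable_exp hs0 hs
  have hfun : ∀ ω, logSpread c (fun t => G k t ω) ^ 4
      = Real.exp (4 / (c * n k) * ∑ t, |Real.log (G k t ω)|) := by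
    intro ω
    rw [logSpread, ← Real.exp_nat_mul]
    congr 1
    push_cast
    ring
  simp only [hfun]
  refine ⟨h.1, h.2.trans (Real.exp_le_exp.2 (le_of_eq ?_))⟩
  rw [← hM]
  field_simp
  ring

theorem tendstoMeanSq_average [IsFiniteMeasure μ] (hG : ∀ k, IsIndepSample P (G k) μ)
    (hn : Tendsto n atTop atTop) {ψ : ℝ → ℝ} (hψm : Measurable ψ) (hψ : MemLp ψ 2 μ) :
    TendstoMeanSq (fun _ => P) (fun k ω => 1 / (n k : ℝ) * ∑ t, ψ (G k t ω)) (∫ x, ψ x ∂μ) := by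
  refine ⟨Eventually.of_forall fun k => (hG k).memLp_average hψm hψ, ?_⟩
  have hlim : Tendsto (fun k => 1 / (n k : ℝ) * ∫ x, ψ x ^ 2 ∂μ) atTop (𝓝 0) := by
    have h1 : Tendsto (fun k => 1 / (n k : ℝ)) atTop (𝓝 0) :=
      tendsto_one_div_atTop_nhds_zero_nat.comp hn
    simpa using h1.mul_const (∫ x, ψ x ^ 2 ∂μ)
  refine squeeze_zero' (Eventually.of_forall fun k => integral_nonneg fun ω => sq_nonneg _) ?_ hlim
  filter_upwards [hn.eventually_gt_atTop 0] with k hk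
  exact (hG k).integral_sq_average_sub_le hk hψm hψ

theorem aemeasurable_comp_sample (hG : ∀ k, IsIndepSample P (G k) μ) (k : ℕ)
    {f : (Fin (n k) → ℝ) → ℝ} (hf : Measurable f) :
    AEMeasurable (fun ω => f fun t => G k t ω) P :=
  hf.comp_aemeasurable (aemeasurable_pi_lambda _ fun t => (hG k).aemeasurable t)

theorem tendstoMeanSq_const [IsProbabilityMeasure P] {x : ℕ → ℝ} {x₀ : ℝ}
    (hx : Tendsto x atTop (𝓝 x₀)) : TendstoMeanSq (fun _ => P) (fun k _ => x k) x₀ := by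
  refine ⟨Eventually.of_forall fun k => memLp_const _, ?_⟩
  simpa using (hx.sub_const x₀).pow 2

/-- Replacing the threshold by the quantile `q` turns the sum over the `N` largest gains into an
average over the sample; by the choice of `q` the number of terms that change is `o(n)`, and each
of them is bounded in terms of `q` and of the threshold. -/
theorem tendstoMeanSq_sum_largest [IsProbabilityMeasure P] (hμ : IsRegularGainLaw μ)
    (hG : ∀ k, IsIndepSample P (G k) μ) (hn : Tendsto n atTop atTop) (hκ0 : 0 < κ) (hκ1 : κ < 1)
    (hN : Tendsto (fun k => (N k : ℝ) / n k) atTop (𝓝 κ)) {q : ℝ}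
    (hq : μ.real (Set.Ioi q) = κ) {φ : ℝ → ℝ} (hφm : Measurable φ)
    (hφ : MemLp ((Set.Ioi q).indicator φ) 2 μ) {C : ℝ} (hC : 0 ≤ C)
    (hφC : ∀ a > 0, ∀ x ∈ Set.uIcc a q, |φ x| ≤ C + Real.exp |Real.log a|) :
    TendstoMeanSq (fun _ => P)
      (fun k ω => 1 / (n k : ℝ) * ∑ i ∈ Finset.Icc 1 (N k), φ (largest (fun t => G k t ω) i))
      (∫ x in Set.Ioi q, φ x ∂μ) := by
  have := hμ.isProbabilityMeasure
  obtain ⟨c, hc, hev⟩ := exists_eventually_mul_le hn hκ0 hκ1 hN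
  obtain ⟨K, hK⟩ := logSpread_fourth_moment hμ hG hc (hev.mono fun k hk => hk.1)
  have hone : MemLp ((Set.Ioi q).indicator fun _ => (1 : ℝ)) 2 μ :=
    (memLp_const (1 : ℝ)).indicator measurableSet_Ioi
  have hcount := tendstoMeanSq_average hG hn
    (measurable_const.indicator measurableSet_Ioi) hone
  have hsum := tendstoMeanSq_average hG hn (hφm.indicator measurableSet_Ioi) hφ
  rw [integral_indicator measurableSet_Ioi] at hcount hsum
  have hD := (tendstoMeanSq_const (P := P) (tendsto_const_nhds (x := (1 : ℝ)))).const_mul_sub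
    hcount hN
  rw [setIntegral_const, hq, smul_eq_mul, sub_self] at hD
  have hindicator : ∀ k ω (ψ : ℝ → ℝ), ∑ t, (Set.Ioi q).indicator ψ (G k t ω)
      = ∑ t ∈ Finset.univ.filter fun t => q < G k t ω, ψ (G k t ω) := by
    intro k ω ψ
    rw [Finset.sum_filter]
    exact Finset.sum_congr rfl fun t _ => by simp [Set.indicator_apply]
  have hrest : TendstoMeanSq (fun _ => P) (fun k ω =>
      1 / (n k : ℝ) * ∑ i ∈ Finset.Icc 1 (N k), φ (largest (fun t => G k t ω) i)
        - 1 / (n k : ℝ) * ∑ t, (Set.Ioi q).indicator φ (G k t ω)) 0 := by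
    refine TendstoMeanSq.of_abs_le_mul (K := (C + 1) ^ 4 * K)
      (V := fun k ω => (C + 1) * logSpread c fun t => G k t ω) ?_ hD ?_ ?_ ?_
    · refine Eventually.of_forall fun k => AEMeasurable.aestronglyMeasurable ?_
      refine aemeasurable_comp_sample hG k (f := fun g => 1 / (n k : ℝ) *
        ∑ i ∈ Finset.Icc 1 (N k), φ (largest g i)
          - 1 / (n k : ℝ) * ∑ t, (Set.Ioi q).indicator φ (g t)) ?_
      refine ((Finset.measurable_sum _ fun i _ => hφm.comp (measurable_largest i)).const_mul _).sub
        ((Finset.measurable_sum _ fun t _ => ?_).const_mul _)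
      exact (hφm.indicator measurableSet_Ioi).comp (measurable_pi_apply t)
    · filter_upwards [hev] with k hk ω
      have hn0 : (0 : ℝ) < n k := by
        by_contra! hneg
        nlinarith [hk.1]
      have h1 : (N k : ℝ) / n k ≤ 1 := by
        rw [div_le_one hn0]
        linarith [hk.1, hk.2.2]
      have h2 : (0 : ℝ) ≤ N k / n k := by positivity
      rw [hindicator k ω fun _ => 1, Finset.sum_const, nsmul_eq_mul, mul_one, mul_one]
      have h3 : ((Finset.univ.filter fun t => q < G k t ω).card : ℝ) ≤ n k := by
        have := Finset.card_le_univ (Finset.univ.filter fun t => q < G k t ω)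
        rw [Fintype.card_fin] at this
        exact_mod_cast this
      have h4 : 1 / (n k : ℝ) * (Finset.univ.filter fun t => q < G k t ω).card ≤ 1 := by
        rw [one_div, ← div_eq_inv_mul, div_le_one hn0]
        exact h3
      have h5 : 0 ≤ 1 / (n k : ℝ) * (Finset.univ.filter fun t => q < G k t ω).card := by
        positivity
      rw [abs_le]
      constructor <;> linarith
    · filter_upwards [hK] with k hk
      simp only [mul_pow]
      refine ⟨hk.1.const_mul _, ?_⟩
      rw [integral_const_mul]
      exact mul_le_mul_of_nonneg_left hk.2 (by positivity)
    · filter_upwards [hev] with k hk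
      filter_upwards [(hG k).ae_comp hμ.ae_pos] with ω hω
      have hcn : 0 < c * n k := by linarith [hk.1]
      have hN1 : 1 ≤ N k := by
        have : (0 : ℝ) < N k := hcn.trans_le hk.2.1
        exact_mod_cast this
      have hNn : N k ≤ n k := by
        have : (N k : ℝ) ≤ n k := by linarith [hk.2.2]
        exact_mod_cast this
      have hU := exp_abs_log_largest_le (g := fun t => G k t ω) hω hcn hk.2.1 hk.2.2
      have hU1 := one_le_logSpread hc.le fun t => G k t ω
      have hbound := abs_sum_largest_sub_sum_exceed_le (g := fun t => G k t ω) hN1 hNn φ q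
        ((C + 1) * logSpread c fun t => G k t ω) fun x hx =>
          (hφC _ (largest_pos hω hN1 hNn) x hx).trans (by nlinarith)
      rw [hindicator, hindicator k ω fun _ => 1, Finset.sum_const, nsmul_eq_mul, mul_one, mul_one,
        ← mul_sub, abs_mul]
      have hsplit : (N k : ℝ) / n k
            - 1 / (n k : ℝ) * (Finset.univ.filter fun t => q < G k t ω).card
          = 1 / (n k : ℝ) * (N k - (Finset.univ.filter fun t => q < G k t ω).card) := by ring
      rw [hsplit, abs_mul, mul_assoc]
      exact mul_le_mul_of_nonneg_left hbound (abs_nonneg _)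
  have := hrest.add hsum
  rw [zero_add] at this
  simpa only [sub_add_cancel] using this

variable {R : ℕ → ℝ} {ρ q : ℝ}

theorem tendstoMeanSq_sum_log_largest [IsProbabilityMeasure P] (hμ : IsRegularGainLaw μ)
    (hG : ∀ k, IsIndepSample P (G k) μ) (hn : Tendsto n atTop atTop) (hκ0 : 0 < κ) (hκ1 : κ < 1)
    (hN : Tendsto (fun k => (N k : ℝ) / n k) atTop (𝓝 κ)) (hq0 : 0 < q)
    (hq : μ.real (Set.Ioi q) = κ) :
    TendstoMeanSq (fun _ => P) (fun k ω =>
        1 / (n k : ℝ) * ∑ i ∈ Finset.Icc 1 (N k), Real.log (largest (fun t => G k t ω) i))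
      (∫ x in Set.Ioi q, Real.log x ∂μ) := by
  refine tendstoMeanSq_sum_largest hμ hG hn hκ0 hκ1 hN hq Real.measurable_log
    (hμ.memLp_log.indicator measurableSet_Ioi) (abs_nonneg (Real.log q)) fun a ha x hx => ?_
  have hlog : Real.log x ∈ Set.uIcc (Real.log a) (Real.log q) := by
    rcases Set.mem_uIcc.1 hx with h | h
    · exact Set.mem_uIcc.2 (Or.inl ⟨Real.log_le_log ha h.1,
        Real.log_le_log (ha.trans_le h.1) h.2⟩)
    · exact Set.mem_uIcc.2 (Or.inr ⟨Real.log_le_log hq0 h.1,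
        Real.log_le_log (hq0.trans_le h.1) h.2⟩)
  have hexp : |Real.log a| ≤ Real.exp |Real.log a| := by
    linarith [Real.add_one_le_exp |Real.log a|]
  have habs : |Real.log x| ≤ |Real.log a| + |Real.log q| := by
    rw [abs_le]
    have := neg_abs_le (Real.log a)
    have := neg_abs_le (Real.log q)
    have := le_abs_self (Real.log a)
    have := le_abs_self (Real.log q)
    have := abs_nonneg (Real.log a)
    have := abs_nonneg (Real.log q)
    rcases Set.mem_uIcc.1 hlog with h | h <;> constructor <;> linarith
  linarith

theorem tendstoMeanSq_sum_inv_largest [IsProbabilityMeasure P] (hμ : IsRegularGainLaw μ)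
    (hG : ∀ k, IsIndepSample P (G k) μ) (hn : Tendsto n atTop atTop) (hκ0 : 0 < κ) (hκ1 : κ < 1)
    (hN : Tendsto (fun k => (N k : ℝ) / n k) atTop (𝓝 κ)) (hq0 : 0 < q)
    (hq : μ.real (Set.Ioi q) = κ) :
    TendstoMeanSq (fun _ => P) (fun k ω =>
        1 / (n k : ℝ) * ∑ i ∈ Finset.Icc 1 (N k), 1 / largest (fun t => G k t ω) i)
      (∫ x in Set.Ioi q, 1 / x ∂μ) := by
  have := hμ.isProbabilityMeasure
  have hm : Measurable fun x : ℝ => 1 / x := measurable_const.div measurable_id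
  refine tendstoMeanSq_sum_largest hμ hG hn hκ0 hκ1 hN hq (φ := fun x => 1 / x) hm ?_
    (one_div_pos.2 hq0).le fun a ha x hx => ?_
  · refine MemLp.of_bound (hm.indicator measurableSet_Ioi).aestronglyMeasurable (1 / q)
      (Eventually.of_forall fun x => ?_)
    by_cases hx : x ∈ Set.Ioi q
    · rw [Set.indicator_of_mem hx, Real.norm_eq_abs,
        abs_of_pos (one_div_pos.2 (hq0.trans hx))]
      exact one_div_le_one_div_of_le hq0 (Set.mem_Ioi.1 hx).le
    · rw [Set.indicator_of_notMem hx, norm_zero]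
      exact (one_div_pos.2 hq0).le
  · have hexp : 1 / a ≤ Real.exp |Real.log a| := by
      rw [← Real.exp_log (one_div_pos.2 ha), Real.exp_le_exp, one_div, Real.log_inv]
      exact neg_le_abs _
    have hq' : 0 < 1 / q := one_div_pos.2 hq0
    have ha' : 0 < 1 / a := one_div_pos.2 ha
    rcases Set.mem_uIcc.1 hx with h | h
    · rw [abs_of_pos (one_div_pos.2 (ha.trans_le h.1))]
      linarith [one_div_le_one_div_of_le ha h.1]
    · rw [abs_of_pos (one_div_pos.2 (hq0.trans_le h.1))]
      linarith [one_div_le_one_div_of_le hq0 h.1]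

theorem tendsto_demand_div (hn : Tendsto n atTop atTop) (hκ0 : 0 < κ)
    (hN : Tendsto (fun k => (N k : ℝ) / n k) atTop (𝓝 κ))
    (hR : Tendsto (fun k => R k / n k) atTop (𝓝 ρ)) :
    Tendsto (fun k => R k / N k) atTop (𝓝 (ρ / κ)) := by
  refine (hR.div hN hκ0.ne').congr' ?_
  filter_upwards [hn.eventually_gt_atTop 0] with k hk
  exact div_div_div_cancel_right₀ (by positivity) _ _

/-- The exponent converges by the limit theorem for `∑ log g`, and the threshold bounds the level,
which gives the fourth moments that turn convergence in probability into mean-square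
convergence. -/
theorem tendstoMeanSq_fullLevel [IsProbabilityMeasure P] (hμ : IsRegularGainLaw μ)
    (hG : ∀ k, IsIndepSample P (G k) μ) (hn : Tendsto n atTop atTop) (hκ0 : 0 < κ) (hκ1 : κ < 1)
    (hN : Tendsto (fun k => (N k : ℝ) / n k) atTop (𝓝 κ))
    (hR : Tendsto (fun k => R k / n k) atTop (𝓝 ρ)) (hq0 : 0 < q)
    (hq : μ.real (Set.Ioi q) = κ) :
    TendstoMeanSq (fun _ => P) (fun k ω => fullLevel (fun t => G k t ω) (N k) (R k))
      (Real.exp (ρ / κ - (∫ x in Set.Ioi q, Real.log x ∂μ) / κ)) := by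
  obtain ⟨c, hc, hev⟩ := exists_eventually_mul_le hn hκ0 hκ1 hN
  obtain ⟨K, hK⟩ := logSpread_fourth_moment hμ hG hc (hev.mono fun k hk => hk.1)
  have hRN := tendsto_demand_div hn hκ0 hN hR
  set L := ∫ x in Set.Ioi q, Real.log x ∂μ with hL
  have hinv : Tendsto (fun k => ((N k : ℝ) / n k)⁻¹) atTop (𝓝 κ⁻¹) := hN.inv₀ hκ0.ne'
  have hZ := (tendstoMeanSq_sum_log_largest hμ hG hn hκ0 hκ1 hN hq0 hq).const_mul_sub
    (tendstoMeanSq_const (P := P) hRN) hinv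
  have hlevel : ∀ᶠ k in atTop, ∀ ω, fullLevel (fun t => G k t ω) (N k) (R k)
      = Real.exp (-(((N k : ℝ) / n k)⁻¹ * (1 / (n k : ℝ) *
          ∑ i ∈ Finset.Icc 1 (N k), Real.log (largest (fun t => G k t ω) i)) - R k / N k)) := by
    filter_upwards [hn.eventually_gt_atTop 0] with k hk ω
    have hn0 : (n k : ℝ) ≠ 0 := by positivity
    rw [fullLevel]
    congr 1
    rw [inv_div, ← mul_assoc, div_mul_div_comm, mul_one, mul_comm (N k : ℝ),
      div_mul_cancel_left₀ hn0, one_div]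
    ring
  have hmeas : ∀ k, AEMeasurable (fun ω => fullLevel (fun t => G k t ω) (N k) (R k)) P := by
    intro k
    refine aemeasurable_comp_sample hG k (f := fun g => fullLevel g (N k) (R k)) ?_
    refine (measurable_const.sub (Measurable.const_mul (Finset.measurable_sum _ fun i _ => ?_)
      _)).exp
    exact Real.measurable_log.comp (measurable_largest i)
  refine TendstoMeanSq.of_tendsto_measure (K := Real.exp (ρ / κ + 1) ^ 4 * K)
    (Eventually.of_forall hmeas) ?_ ?_
  · filter_upwards [hK, hev, hRN.eventually_lt_const (lt_add_one _)] with k hk1 hk2 hk3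
    have hcn : 0 < c * n k := by linarith [hk2.1]
    have hN0 : (0 : ℝ) < N k := hcn.trans_le hk2.2.1
    have hN1 : 1 ≤ N k := by exact_mod_cast hN0
    have hNn : N k ≤ n k := by
      have : (N k : ℝ) ≤ n k := by linarith [hk2.2.2]
      exact_mod_cast this
    have hle : ∀ᵐ ω ∂P, fullLevel (fun t => G k t ω) (N k) (R k) ^ 4
        ≤ Real.exp (ρ / κ + 1) ^ 4 * logSpread c (fun t => G k t ω) ^ 4 := by
      filter_upwards [(hG k).ae_comp hμ.ae_pos] with ω hω
      have hU := exp_abs_log_largest_le (g := fun t => G k t ω) hω hcn hk2.2.1 hk2.2.2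
      rw [← mul_pow]
      refine pow_le_pow_left₀ (fullLevel_pos _ _ _).le ?_ 4
      refine le_trans ?_ (mul_le_mul_of_nonneg_left hU (Real.exp_pos _).le)
      rw [fullLevel, ← Real.exp_add, Real.exp_le_exp]
      have hsum : (N k : ℝ) * Real.log (largest (fun t => G k t ω) (N k))
          ≤ ∑ i ∈ Finset.Icc 1 (N k), Real.log (largest (fun t => G k t ω) i) := by
        have := Finset.card_nsmul_le_sum (Finset.Icc 1 (N k))
          (fun i => Real.log (largest (fun t => G k t ω) i))
          (Real.log (largest (fun t => G k t ω) (N k))) fun i hi => by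
            rw [Finset.mem_Icc] at hi
            exact Real.log_le_log (largest_pos hω hN1 hNn) (largest_le_largest hi.1 hi.2 hNn)
        simpa using this
      have havg : Real.log (largest (fun t => G k t ω) (N k)) ≤ 1 / (N k : ℝ) *
          ∑ i ∈ Finset.Icc 1 (N k), Real.log (largest (fun t => G k t ω) i) := by
        rw [one_div, ← div_eq_inv_mul, le_div_iff₀ hN0, mul_comm]
        exact hsum
      have := neg_abs_le (Real.log (largest (fun t => G k t ω) (N k)))
      linarith
    have hi : Integrable (fun ω => fullLevel (fun t => G k t ω) (N k) (R k) ^ 4) P := by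
      refine (hk1.1.const_mul (Real.exp (ρ / κ + 1) ^ 4)).mono'
        ((hmeas k).pow_const 4).aestronglyMeasurable ?_
      filter_upwards [hle] with ω hω
      rwa [Real.norm_eq_abs, abs_of_nonneg (by positivity)]
    refine ⟨hi, (integral_mono_ae hi (hk1.1.const_mul _) hle).trans ?_⟩
    rw [integral_const_mul]
    exact mul_le_mul_of_nonneg_left hk1.2 (by positivity)
  · intro ε hε
    have hcont : Continuous fun z : ℝ => Real.exp (-z) := by fun_prop
    obtain ⟨δ, hδ, hδε⟩ := Metric.continuous_iff.1 hcont (κ⁻¹ * L - ρ / κ) ε hε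
    have hprob := hZ.tendsto_measure (Eventually.of_forall fun _ => inferInstance) hδ
    refine squeeze_zero' (Eventually.of_forall fun k => measureReal_nonneg) ?_ hprob
    filter_upwards [hlevel] with k hk
    refine measureReal_mono fun ω hω => ?_
    rw [Set.mem_ofPred_eq, hk ω] at hω
    rw [Set.mem_ofPred_eq]
    by_contra! hlt
    have := hδε _ hlt
    rw [Real.dist_eq, show -(κ⁻¹ * L - ρ / κ) = ρ / κ - L / κ by ring] at this
    exact absurd hω (not_le.2 this)

theorem tendstoMeanSq_fullPower [IsProbabilityMeasure P] (hμ : IsRegularGainLaw μ)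
    (hG : ∀ k, IsIndepSample P (G k) μ) (hn : Tendsto n atTop atTop) (hκ0 : 0 < κ) (hκ1 : κ < 1)
    (hN : Tendsto (fun k => (N k : ℝ) / n k) atTop (𝓝 κ))
    (hR : Tendsto (fun k => R k / n k) atTop (𝓝 ρ)) (hq0 : 0 < q)
    (hq : μ.real (Set.Ioi q) = κ) :
    TendstoMeanSq (fun _ => P) (fun k ω => fullPower (fun t => G k t ω) (N k) (R k))
      (κ * Real.exp (ρ / κ - (∫ x in Set.Ioi q, Real.log x ∂μ) / κ)
        - ∫ x in Set.Ioi q, 1 / x ∂μ) :=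
  (tendstoMeanSq_fullLevel hμ hG hn hκ0 hκ1 hN hR hq0 hq).const_mul_sub
    (tendstoMeanSq_sum_inv_largest hμ hG hn hκ0 hκ1 hN hq0 hq) hN

end Asymptotics

/-! ### The actual water-filling level -/

section ActualLevel

variable {Ω : Type*} [MeasurableSpace Ω] {P : Measure Ω}

/-- Conditioning on events of probability at least `c` multiplies the mean-square distance by at
most `1 / c`. -/
theorem TendstoMeanSq.cond [IsProbabilityMeasure P] {X Y : ℕ → Ω → ℝ} {m : ℝ}
    (hX : TendstoMeanSq (fun _ => P) X m) {A : ℕ → Set Ω} (hA : ∀ k, NullMeasurableSet (A k) P) {c : ℝ} (hc : 0 < c)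
    (hcA : ∀ᶠ k in atTop, c ≤ P.real (A k))
    (hY : ∀ᶠ k in atTop, ∀ᵐ ω ∂P, ω ∈ A k → Y k ω = X k ω) :
    TendstoMeanSq (fun k => P[|A k]) Y m := by
  have heq : ∀ᶠ k in atTop, Y k =ᵐ[P[|A k]] X k := by
    filter_upwards [hY] with k hk
    exact Measure.ae_smul_measure ((ae_restrict_iff'₀ (hA k)).2 hk) _
  refine ⟨?_, ?_⟩
  · filter_upwards [heq, hX.1, hcA] with k h1 h2 h3
    refine (memLp_congr_ae h1).2 (h2.restrict (A k) |>.smul_measure ?_)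
    rw [ENNReal.inv_ne_top]
    intro h0
    rw [measureReal_def, h0, ENNReal.toReal_zero] at h3
    linarith
  · have hlim : Tendsto (fun k => c⁻¹ * ∫ ω, (X k ω - m) ^ 2 ∂P) atTop (𝓝 0) := by
      simpa using hX.2.const_mul c⁻¹
    refine squeeze_zero' (Eventually.of_forall fun k => integral_nonneg fun ω => sq_nonneg _) ?_
      hlim
    filter_upwards [heq, hX.1, hcA] with k h1 h2 h3
    have h4 : ∫ ω, (Y k ω - m) ^ 2 ∂P[|A k] = ∫ ω, (X k ω - m) ^ 2 ∂P[|A k] := by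
      refine integral_congr_ae ?_
      filter_upwards [h1] with ω hω
      rw [hω]
    have hi := integrable_sq_sub h2 m
    rw [h4, ProbabilityTheory.cond, integral_smul_measure, ENNReal.toReal_inv, smul_eq_mul]
    refine mul_le_mul (inv_anti₀ hc h3)
      (setIntegral_le_integral hi (Eventually.of_forall fun ω => sq_nonneg _))
      (integral_nonneg fun ω => sq_nonneg _) (by positivity)

theorem eventually_isProbabilityMeasure_cond [IsProbabilityMeasure P] {A : ℕ → Set Ω} {c : ℝ}
    (hc : 0 < c) (hcA : ∀ᶠ k in atTop, c ≤ P.real (A k)) :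
    ∀ᶠ k in atTop, IsProbabilityMeasure P[|A k] := by
  filter_upwards [hcA] with k hk
  refine cond_isProbabilityMeasure fun h0 => ?_
  rw [measureReal_def, h0, ENNReal.toReal_zero] at hk
  linarith

/-- A variable that agrees with `X` on events of probability tending to one, and that is dominated
by a variable converging in mean square, has the mean-square limit of `X`. -/
theorem TendstoMeanSq.of_eq_on [IsProbabilityMeasure P] {X Y F : ℕ → Ω → ℝ} {m m' : ℝ}
    (hX : TendstoMeanSq (fun _ => P) X m) (hF : TendstoMeanSq (fun _ => P) F m')
    {A : ℕ → Set Ω} (hA : ∀ k, NullMeasurableSet (A k) P)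
    (hA1 : Tendsto (fun k => P.real (A k)) atTop (𝓝 1))
    (hYm : ∀ k, AEMeasurable (Y k) P)
    (hY : ∀ᶠ k in atTop, ∀ᵐ ω ∂P, ω ∈ A k → Y k ω = X k ω)
    (hYF : ∀ᶠ k in atTop, ∀ᵐ ω ∂P, |Y k ω| ≤ F k ω) :
    TendstoMeanSq (fun _ => P) Y m := by
  set b := 4 * m' ^ 2 + 2 * m ^ 2 with hb
  have hind : ∀ k, Integrable ((A k)ᶜ.indicator fun _ => b) P := fun k =>
    (integrable_const b).indicator₀ (hA k).compl
  refine TendstoMeanSq.of_sq_le (B := fun k ω => (X k ω - m) ^ 2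
    + (4 * (F k ω - m') ^ 2 + (A k)ᶜ.indicator (fun _ => b) ω))
    (Eventually.of_forall fun _ => inferInstance)
    (Eventually.of_forall fun k => (hYm k).aestronglyMeasurable) ?_ ?_ ?_
  · filter_upwards [hX.1, hF.1] with k h1 h2
    exact (integrable_sq_sub h1 m).add (((integrable_sq_sub h2 m').const_mul 4).add (hind k))
  · filter_upwards [hY, hYF] with k h1 h2
    filter_upwards [h1, h2] with ω h3 h4
    by_cases hω : ω ∈ A k
    · rw [Set.indicator_of_notMem (Set.notMem_compl_iff.2 hω), h3 hω]
      nlinarith [sq_nonneg (F k ω - m')]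
    · rw [Set.indicator_of_mem (Set.mem_compl hω)]
      have h5 := pow_le_pow_left₀ (abs_nonneg _) h4 2
      rw [sq_abs] at h5
      nlinarith [sq_nonneg (X k ω - m), sq_nonneg (Y k ω + m), sq_nonneg (F k ω - 2 * m')]
  · have hcompl : Tendsto (fun k => P.real (A k)ᶜ * b) atTop (𝓝 0) := by
      have h1 : ∀ k, P.real (A k)ᶜ = 1 - P.real (A k) := fun k => by
        rw [measureReal_compl₀ (hA k), probReal_univ]
      simp only [h1]
      simpa using (hA1.const_sub 1).mul_const b
    have hlim := hX.2.add ((hF.2.const_mul 4).add hcompl)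
    simp only [mul_zero, add_zero] at hlim
    refine hlim.congr' ?_
    filter_upwards [hX.1, hF.1] with k h1 h2
    have i1 := (integrable_sq_sub h2 m').const_mul 4
    have i2 : Integrable (fun ω => 4 * (F k ω - m') ^ 2 + (A k)ᶜ.indicator (fun _ => b) ω) P :=
      i1.add (hind k)
    rw [integral_add (integrable_sq_sub h1 m) i2, integral_add i1 (hind k), integral_const_mul,
      integral_indicator₀ (hA k).compl, setIntegral_const, smul_eq_mul]

theorem measurable_transmitPower (n N : ℕ) :
    Measurable fun z : (Fin n → ℝ) × ℝ => transmitPower z.1 N z.2 := by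
  refine Measurable.const_mul (Finset.measurable_sum _ fun t _ => ?_) _
  simp only [slotPower, activeSlots, Finset.mem_filter, Finset.mem_univ, true_and]
  have hcoord : Measurable fun z : (Fin n → ℝ) × ℝ => z.1 t :=
    (measurable_pi_apply t).comp measurable_fst
  refine Measurable.ite (measurableSet_le ?_ hcoord)
    (measurable_snd.sub (measurable_const.div hcoord)) measurable_const
  exact ((measurable_largest N).comp measurable_fst).max (measurable_const.div measurable_snd)

variable {n N : ℕ → ℕ} {G : (k : ℕ) → Fin (n k) → Ω → ℝ} {μ : Measure ℝ} {κ : ℝ} {R : ℕ → ℝ}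
  {ν : ℕ → Ω → ℝ} {m m' : ℝ}

theorem nullMeasurableSet_allActive (hG : ∀ k, IsIndepSample P (G k) μ)
    (hν : ∀ k, AEMeasurable (ν k) P) (k : ℕ) :
    NullMeasurableSet {ω | 1 ≤ ν k ω * threshold (fun t => G k t ω) (N k)} P :=
  nullMeasurableSet_le aemeasurable_const
    ((hν k).mul (aemeasurable_comp_sample hG k (measurable_largest (N k))))

theorem ae_waterLevel (hμ : IsRegularGainLaw μ) (hG : ∀ k, IsIndepSample P (G k) μ)
    (hn : Tendsto n atTop atTop) (hκ0 : 0 < κ) (hκ1 : κ < 1)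
    (hN : Tendsto (fun k => (N k : ℝ) / n k) atTop (𝓝 κ))
    (hν : ∀ᶠ k in atTop, ∀ᵐ ω ∂P, IsWaterLevel (fun t => G k t ω) (N k) (R k) (ν k ω)) :
    ∀ᶠ k in atTop, ∀ᵐ ω ∂P,
      (1 ≤ ν k ω * threshold (fun t => G k t ω) (N k) →
        ν k ω = fullLevel (fun t => G k t ω) (N k) (R k) ∧
        transmitPower (fun t => G k t ω) (N k) (ν k ω)
          = fullPower (fun t => G k t ω) (N k) (R k)) ∧
      |ν k ω| ≤ fullLevel (fun t => G k t ω) (N k) (R k) ∧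
      |transmitPower (fun t => G k t ω) (N k) (ν k ω)|
        ≤ fullLevel (fun t => G k t ω) (N k) (R k) := by
  have := hμ.nullSingletonClass
  obtain ⟨c, hc, hev⟩ := exists_eventually_mul_le hn hκ0 hκ1 hN
  filter_upwards [hev, hν] with k hk1 hk2
  filter_upwards [hk2, (hG k).ae_comp hμ.ae_pos, (hG k).ae_injective] with ω h hpos hinj
  have hN0 : (0 : ℝ) < N k := by linarith [hk1.1, hk1.2.1]
  have hN1 : 1 ≤ N k := by exact_mod_cast hN0
  have hNn : N k ≤ n k := by
    have : (N k : ℝ) ≤ n k := by linarith [hk1.1, hk1.2.2]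
    exact_mod_cast this
  have hle := h.le_fullLevel hpos hinj hN1 hNn
  have hp := h.transmitPower_mem_Icc hpos
  refine ⟨fun h1 => ⟨h.eq_fullLevel hinj hN1 hNn h1, h.transmitPower_eq hinj hN1 hNn h1⟩, ?_, ?_⟩
  · rwa [abs_of_pos h.pos]
  · rw [abs_of_nonneg hp.1]
    exact hp.2.trans hle

theorem hasMeanLimitAndConcentrates_waterLevel [IsProbabilityMeasure P]
    (hμ : IsRegularGainLaw μ) (hG : ∀ k, IsIndepSample P (G k) μ) (hn : Tendsto n atTop atTop)
    (hκ0 : 0 < κ) (hκ1 : κ < 1) (hN : Tendsto (fun k => (N k : ℝ) / n k) atTop (𝓝 κ))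
    (hF : TendstoMeanSq (fun _ => P) (fun k ω => fullLevel (fun t => G k t ω) (N k) (R k)) m)
    (hF' : TendstoMeanSq (fun _ => P) (fun k ω => fullPower (fun t => G k t ω) (N k) (R k)) m')
    (hνm : ∀ k, AEMeasurable (ν k) P)
    (hν : ∀ᶠ k in atTop, ∀ᵐ ω ∂P, IsWaterLevel (fun t => G k t ω) (N k) (R k) (ν k ω)) :
    ((∃ c : ℝ, 0 < c ∧ ∀ᶠ k in atTop,
        c ≤ P.real {ω | 1 ≤ ν k ω * threshold (fun t => G k t ω) (N k)}) →
      HasMeanLimitAndConcentrates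
        (fun k => P[|{ω | 1 ≤ ν k ω * threshold (fun t => G k t ω) (N k)}]) ν m ∧
      HasMeanLimitAndConcentrates
        (fun k => P[|{ω | 1 ≤ ν k ω * threshold (fun t => G k t ω) (N k)}])
        (fun k ω => transmitPower (fun t => G k t ω) (N k) (ν k ω)) m') ∧
    (Tendsto (fun k => P.real {ω | 1 ≤ ν k ω * threshold (fun t => G k t ω) (N k)})
        atTop (𝓝 1) →
      HasMeanLimitAndConcentrates (fun _ => P) ν m ∧
      HasMeanLimitAndConcentrates (fun _ => P)
        (fun k ω => transmitPower (fun t => G k t ω) (N k) (ν k ω)) m') := by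
  have hA := nullMeasurableSet_allActive (N := N) hG hνm
  have hae := ae_waterLevel hμ hG hn hκ0 hκ1 hN hν
  have hlevel : ∀ᶠ k in atTop, ∀ᵐ ω ∂P,
      ω ∈ {ω | 1 ≤ ν k ω * threshold (fun t => G k t ω) (N k)} →
        ν k ω = fullLevel (fun t => G k t ω) (N k) (R k) :=
    hae.mono fun k hk => hk.mono fun ω hω h1 => (hω.1 h1).1
  have hpower : ∀ᶠ k in atTop, ∀ᵐ ω ∂P,
      ω ∈ {ω | 1 ≤ ν k ω * threshold (fun t => G k t ω) (N k)} →
        transmitPower (fun t => G k t ω) (N k) (ν k ω)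
          = fullPower (fun t => G k t ω) (N k) (R k) :=
    hae.mono fun k hk => hk.mono fun ω hω h1 => (hω.1 h1).2
  constructor
  · rintro ⟨c, hc, hcA⟩
    have hprob := eventually_isProbabilityMeasure_cond hc hcA
    exact ⟨(hF.cond hA hc hcA hlevel).hasMeanLimitAndConcentrates hprob,
      (hF'.cond hA hc hcA hpower).hasMeanLimitAndConcentrates hprob⟩
  · intro hA1
    have hprob : ∀ᶠ k in (atTop : Filter ℕ), IsProbabilityMeasure ((fun _ => P) k) :=
      Eventually.of_forall fun _ => inferInstance
    have hlevelF : ∀ᶠ k in atTop, ∀ᵐ ω ∂P,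
        |ν k ω| ≤ fullLevel (fun t => G k t ω) (N k) (R k) :=
      hae.mono fun k hk => hk.mono fun ω hω => hω.2.1
    have hpowerF : ∀ᶠ k in atTop, ∀ᵐ ω ∂P, |transmitPower (fun t => G k t ω) (N k) (ν k ω)|
        ≤ fullLevel (fun t => G k t ω) (N k) (R k) :=
      hae.mono fun k hk => hk.mono fun ω hω => hω.2.2
    have hpowerm : ∀ k, AEMeasurable
        (fun ω => transmitPower (fun t => G k t ω) (N k) (ν k ω)) P := fun k =>
      (measurable_transmitPower (n k) (N k)).comp_aemeasurable
        (f := fun ω => ((fun t => G k t ω), ν k ω))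
        ((aemeasurable_pi_lambda (fun ω t => G k t ω) fun t => (hG k).aemeasurable t).prodMk
          (hνm k))
    exact ⟨(hF.of_eq_on hF hA hA1 hνm hlevel hlevelF).hasMeanLimitAndConcentrates hprob,
      (hF'.of_eq_on hF hA hA1 hpowerm hpower hpowerF).hasMeanLimitAndConcentrates hprob⟩

end ActualLevel

/-! ### The law of the channel gains -/

section GammaLaw

open Complex in
/-- Each derivative in `w` of `∫ exp (w x)` brings down one more factor `x`. -/
theorem integral_pow_mul_cexp_Ioi (k : ℕ) {w : ℂ} (hw : w.re < 0) :
    ∫ x : ℝ in Set.Ioi 0, (x : ℂ) ^ k * cexp (w * x) = k.factorial / (-w) ^ (k + 1) := by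
  have hint : Set.Iio (0 : ℝ) ⊆ interior (integrableExpSet id (volume.restrict (Set.Ioi 0))) := by
    refine interior_maximal (fun t ht => ?_) isOpen_Iio
    exact integrableOn_exp_mul_Ioi ht 0
  induction k generalizing w with
  | zero =>
    have h0 := integral_exp_mul_complex_Ioi hw 0
    have hw0 : w ≠ 0 := by
      rintro rfl
      simp at hw
    simp [h0, div_neg, neg_div]
  | succ k ih =>
    have hd := hasDerivAt_integral_pow_mul_exp (hint hw) k
    simp only [id] at hd
    have hev : (fun z : ℂ => ∫ x : ℝ in Set.Ioi 0, (x : ℂ) ^ k * cexp (z * x))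
        =ᶠ[𝓝 w] fun z => k.factorial / (-z) ^ (k + 1) := by
      filter_upwards [(isOpen_lt Complex.continuous_re continuous_const).mem_nhds hw] with z hz
      exact ih hz
    have hw0 : -w ≠ 0 := by
      intro h
      rw [neg_eq_zero.1 h] at hw
      simp at hw
    have hd2 : HasDerivAt (fun z : ℂ => (k.factorial : ℂ) / (-z) ^ (k + 1))
        ((k + 1).factorial / (-w) ^ (k + 1 + 1)) w := by
      have h1 : HasDerivAt (fun z : ℂ => (-z) ^ (k + 1))
          (((k + 1 : ℕ) : ℂ) * (-w) ^ k * (-1)) w := by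
        exact (hasDerivAt_neg w).pow (k + 1)
      have h2 := (hasDerivAt_const w (k.factorial : ℂ)).div h1 (pow_ne_zero _ hw0)
      convert! h2 using 1
      rw [Nat.factorial_succ]
      push_cast
      field_simp
      ring
    exact (hd.congr_of_eventuallyEq hev.symm).unique hd2

theorem gammaPDFReal_natCast {a : ℕ} (ha : 0 < a) (r : ℝ) {x : ℝ} (hx : 0 < x) :
    gammaPDFReal a r x = r ^ a / Real.Gamma a * x ^ (a - 1) * Real.exp (-(r * x)) := by
  rw [gammaPDFReal, if_pos hx.le, Real.rpow_natCast, ← Nat.cast_pred ha, Real.rpow_natCast]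

theorem charFun_gammaMeasure {a : ℕ} (ha : 0 < a) {r : ℝ} (hr : 0 < r) (t : ℝ) :
    charFun (gammaMeasure a r) t = (r / (r - t * Complex.I)) ^ a := by
  have ha' : (0 : ℝ) < a := by exact_mod_cast ha
  have hre : (-(r - t * Complex.I : ℂ)).re < 0 := by simpa using hr
  rw [charFun_apply_real, gammaMeasure, integral_withDensity_eq_integral_toReal_smul
    (f := gammaPDF a r) (measurable_gammaPDFReal a r).ennreal_ofReal
    (Eventually.of_forall fun x => ENNReal.ofReal_lt_top)]
  have hset : ∫ x : ℝ, (gammaPDF a r x).toReal • Complex.exp (t * x * Complex.I)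
      = ∫ x in Set.Ioi (0 : ℝ), (gammaPDF a r x).toReal • Complex.exp (t * x * Complex.I) := by
    rw [← integral_Ici_eq_integral_Ioi, setIntegral_eq_integral_of_forall_compl_eq_zero]
    intro x hx
    rw [Set.mem_Ici, not_le] at hx
    rw [gammaPDF_of_neg hx]
    simp
  have hfun : ∀ x ∈ Set.Ioi (0 : ℝ), (gammaPDF a r x).toReal • Complex.exp (t * x * Complex.I)
      = ((r ^ a / Real.Gamma a : ℝ) : ℂ) * ((x : ℂ) ^ (a - 1)
          * Complex.exp (-(r - t * Complex.I) * x)) := by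
    intro x hx
    rw [gammaPDF, ENNReal.toReal_ofReal (gammaPDFReal_nonneg ha' hr x),
      gammaPDFReal_natCast ha r hx, Complex.real_smul]
    push_cast
    rw [show -((r : ℂ) - t * Complex.I) * x = -(r * x) + t * x * Complex.I by ring,
      Complex.exp_add]
    ring
  rw [hset, setIntegral_congr_fun measurableSet_Ioi hfun, integral_const_mul,
    integral_pow_mul_cexp_Ioi (a - 1) hre, Nat.sub_add_cancel ha, neg_neg]
  have hG : Real.Gamma a = (a - 1).factorial := by
    rw [← Real.Gamma_nat_eq_factorial, Nat.cast_pred ha, sub_add_cancel]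
  have hf : ((a - 1).factorial : ℂ) ≠ 0 := by exact_mod_cast (a - 1).factorial_ne_zero
  rw [hG]
  push_cast
  rw [div_pow]
  field_simp

theorem exp_half_abs_log_le {x : ℝ} (hx : 0 < x) :
    Real.exp (1 / 2 * |Real.log x|) ≤ x ^ (1 / 2 : ℝ) + x ^ (-1 / 2 : ℝ) := by
  have h1 : 0 < x ^ (1 / 2 : ℝ) := Real.rpow_pos_of_pos hx _
  have h2 : 0 < x ^ (-1 / 2 : ℝ) := Real.rpow_pos_of_pos hx _
  rcases abs_cases (Real.log x) with h | h
  · rw [h.1, mul_comm, ← Real.rpow_def_of_pos hx]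
    linarith
  · rw [h.1, show 1 / 2 * -Real.log x = Real.log x * (-1 / 2) by ring,
      ← Real.rpow_def_of_pos hx]
    linarith

theorem integrable_exp_gammaMeasure {a : ℕ} (ha : 0 < a) {r : ℝ} (hr : 0 < r) :
    Integrable (fun x => Real.exp (1 / 2 * |Real.log x|)) (gammaMeasure a r) := by
  have ha' : (1 : ℝ) ≤ a := by exact_mod_cast ha
  have hm : Measurable fun x : ℝ => Real.exp (1 / 2 * |Real.log x|) :=
    ((continuous_abs.measurable.comp Real.measurable_log).const_mul _).exp
  rw [gammaMeasure, integrable_withDensity_iff_integrable_smul'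
    (f := gammaPDF a r) (measurable_gammaPDFReal a r).ennreal_ofReal
    (Eventually.of_forall fun x => ENNReal.ofReal_lt_top)]
  have hpow : ∀ s : ℝ, -1 < s → IntegrableOn (fun x : ℝ => x ^ s * Real.exp (-r * x)) (Set.Ioi 0) :=
    fun s hs => by simpa using integrableOn_rpow_mul_exp_neg_mul_rpow hs one_pos hr
  have hdom : IntegrableOn (fun x : ℝ => r ^ (a : ℝ) / Real.Gamma a *
      (x ^ (a - 1 + 1 / 2 : ℝ) * Real.exp (-r * x)
        + x ^ (a - 1 + -1 / 2 : ℝ) * Real.exp (-r * x))) (Set.Ioi 0) :=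
    ((hpow _ (by linarith)).add (hpow _ (by linarith))).const_mul _
  have hG : 0 < Real.Gamma a := Real.Gamma_pos_of_pos (by linarith)
  have hIoi : IntegrableOn (fun x => (gammaPDF a r x).toReal • Real.exp (1 / 2 * |Real.log x|))
      (Set.Ioi 0) := by
    refine hdom.mono' ?_ ?_
    · exact (((measurable_gammaPDFReal a r).ennreal_ofReal.ennreal_toReal).mul
        hm).aestronglyMeasurable
    · filter_upwards [ae_restrict_mem measurableSet_Ioi] with x hx
      have hx0 : 0 < x := hx
      rw [gammaPDF, ENNReal.toReal_ofReal (gammaPDFReal_nonneg (by linarith) hr x), smul_eq_mul,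
        Real.norm_eq_abs, abs_of_nonneg (mul_nonneg (gammaPDFReal_nonneg (by linarith) hr x)
          (Real.exp_pos _).le), gammaPDFReal, if_pos hx0.le, Real.rpow_add hx0, Real.rpow_add hx0,
        ← neg_mul]
      have := mul_le_mul_of_nonneg_left (exp_half_abs_log_le hx0)
        (show 0 ≤ r ^ (a : ℝ) / Real.Gamma a * x ^ ((a : ℝ) - 1) * Real.exp (-r * x) by positivity)
      linarith
  have hIic : IntegrableOn (fun x => (gammaPDF a r x).toReal • Real.exp (1 / 2 * |Real.log x|))
      (Set.Iio 0) := by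
    refine integrableOn_zero.congr_fun (fun x hx => ?_) measurableSet_Iio
    rw [gammaPDF_of_neg hx]
    simp
  rw [← integrableOn_univ, ← Set.Iio_union_Ici (a := (0 : ℝ)), integrableOn_union,
    integrableOn_Ici_iff_integrableOn_Ioi]
  exact ⟨hIic, hIoi⟩

end GammaLaw

section GainLaw

variable {Tf Nt : ℕ} {α : Fin Tf → ℝ} {σ : ℝ}

/-- The law with density `gainPDF α σ Nt`, which is the equal mixture of the Gamma laws of the
frames. -/
def gainLaw (α : Fin Tf → ℝ) (σ : ℝ) (Nt : ℕ) : Measure ℝ :=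
  volume.withDensity fun g => ENNReal.ofReal (gainPDF α σ Nt g)

theorem measurable_gainPDF (α : Fin Tf → ℝ) (σ : ℝ) (Nt : ℕ) : Measurable (gainPDF α σ Nt) := by
  refine Measurable.ite measurableSet_Ioi ?_ measurable_const
  exact (Finset.measurable_sum _ fun j _ => by fun_prop).const_mul _

theorem gainPDF_eq_average (hNt : 0 < Nt) (α : Fin Tf → ℝ) (σ : ℝ) {g : ℝ} (hg : 0 < g) :
    gainPDF α σ Nt g = 1 / (Tf : ℝ) * ∑ j, gammaPDFReal Nt (σ ^ 2 / α j) g := by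
  rw [gainPDF, if_pos hg]
  congr 1
  refine Finset.sum_congr rfl fun j _ => ?_
  rw [gammaPDFReal_natCast hNt _ hg, mul_pow]
  obtain ⟨m, rfl⟩ := Nat.exists_eq_succ_of_ne_zero hNt.ne'
  rw [Nat.succ_eq_add_one, Nat.add_sub_cancel, pow_succ]
  ring

theorem gainPDF_nonneg (hNt : 0 < Nt) (hα : ∀ j, 0 < α j) (hσ : 0 < σ) (g : ℝ) :
    0 ≤ gainPDF α σ Nt g := by
  have hN : (0 : ℝ) < Nt := by exact_mod_cast hNt
  rcases lt_or_ge 0 g with hg | hg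
  · rw [gainPDF_eq_average hNt α σ hg]
    exact mul_nonneg (by positivity) (Finset.sum_nonneg fun j _ =>
      gammaPDFReal_nonneg hN (div_pos (by positivity) (hα j)) g)
  · rw [gainPDF, if_neg hg.not_gt]

theorem gainLaw_eq_average (hNt : 0 < Nt) (hα : ∀ j, 0 < α j) (hσ : 0 < σ) :
    gainLaw α σ Nt = (Tf : ENNReal)⁻¹ • ∑ j, gammaMeasure Nt (σ ^ 2 / α j) := by
  have hN : (0 : ℝ) < Nt := by exact_mod_cast hNt
  have hm : ∀ j, Measurable (gammaPDF Nt (σ ^ 2 / α j)) := fun j =>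
    (measurable_gammaPDFReal _ _).ennreal_ofReal
  have hsum : (∑ j, gammaMeasure Nt (σ ^ 2 / α j))
      = volume.withDensity fun g => ∑ j, gammaPDF Nt (σ ^ 2 / α j) g := by
    ext s hs
    rw [Measure.finsetSum_apply, withDensity_apply _ hs, lintegral_finsetSum _ fun j _ => hm j]
    exact Finset.sum_congr rfl fun j _ => by rw [gammaMeasure, withDensity_apply _ hs]
  rw [hsum, ← withDensity_smul _ (Finset.measurable_sum _ fun j _ => hm j)]
  refine withDensity_congr_ae ?_
  -- At `0` the two densities differ when `Nt = 1`.
  have h0 : ∀ᵐ g : ℝ, g ≠ 0 := by simp [ae_iff]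
  filter_upwards [h0] with g hg
  rw [Pi.smul_apply, smul_eq_mul]
  rcases lt_or_gt_of_ne hg with hg | hg
  · rw [gainPDF, if_neg hg.not_gt]
    simp [gammaPDF_of_neg hg]
  · have hTf : (Tf : ENNReal)⁻¹ = ENNReal.ofReal (1 / (Tf : ℝ)) ∨ Tf = 0 := by
      rcases Nat.eq_zero_or_pos Tf with h | h
      · exact Or.inr h
      · left
        rw [one_div, ENNReal.ofReal_inv_of_pos (by exact_mod_cast h), ENNReal.ofReal_natCast]
    rw [gainPDF_eq_average hNt α σ hg]
    rcases hTf with hTf | hTf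
    · rw [ENNReal.ofReal_mul (by positivity), ENNReal.ofReal_sum_of_nonneg fun j _ =>
        gammaPDFReal_nonneg hN (div_pos (by positivity) (hα j)) g, hTf]
      rfl
    · subst hTf
      simp

theorem isRegularGainLaw_gainLaw (hTf : 0 < Tf) (hNt : 0 < Nt) (hα : ∀ j, 0 < α j) (hσ : 0 < σ) :
    IsRegularGainLaw (gainLaw α σ Nt) := by
  have hN : (0 : ℝ) < Nt := by exact_mod_cast hNt
  have hr : ∀ j, 0 < σ ^ 2 / α j := fun j => div_pos (by positivity) (hα j)
  have hTf0 : (Tf : ENNReal) ≠ 0 := by exact_mod_cast hTf.ne'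
  refine ⟨⟨?_⟩, ⟨fun x => ?_⟩, ?_, ?_⟩
  · rw [gainLaw_eq_average hNt hα hσ, Measure.smul_apply, Measure.finsetSum_apply]
    have hone : ∀ j, gammaMeasure Nt (σ ^ 2 / α j) Set.univ = 1 := fun j => by
      have := isProbabilityMeasure_gammaMeasure hN (hr j)
      exact measure_univ
    simp only [hone, Finset.sum_const, Finset.card_univ, Fintype.card_fin, nsmul_eq_mul, mul_one,
      smul_eq_mul]
    exact ENNReal.inv_mul_cancel hTf0 (ENNReal.natCast_ne_top _)
  · exact withDensity_absolutelyContinuous _ _ (measure_singleton x)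
  · rw [gainLaw, ae_withDensity_iff (measurable_gainPDF α σ Nt).ennreal_ofReal]
    refine Eventually.of_forall fun x hx => ?_
    by_contra hx0
    rw [gainPDF, if_neg hx0] at hx
    simp at hx
  · rw [gainLaw_eq_average hNt hα hσ]
    refine Integrable.smul_measure ?_ (ENNReal.inv_ne_top.2 hTf0)
    exact integrable_finsetSum_measure.2 fun j _ => integrable_exp_gammaMeasure hNt (hr j)

theorem setIntegral_gainLaw (hNt : 0 < Nt) (hα : ∀ j, 0 < α j) (hσ : 0 < σ) (ψ : ℝ → ℝ)
    {s : Set ℝ} (hs : MeasurableSet s) :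
    ∫ g in s, ψ g ∂(gainLaw α σ Nt) = ∫ g in s, ψ g * gainPDF α σ Nt g := by
  rw [gainLaw, setIntegral_withDensity_eq_setIntegral_toReal_smul
    (measurable_gainPDF α σ Nt).ennreal_ofReal
    (Eventually.of_forall fun x => ENNReal.ofReal_lt_top) _ hs]
  refine integral_congr_ae (Eventually.of_forall fun g => ?_)
  simp only [smul_eq_mul]
  rw [ENNReal.toReal_ofReal (gainPDF_nonneg hNt hα hσ g), mul_comm]

end GainLaw

section BlockFading

open Complex in
/-- The square avoids the branch of the complex square root in the Gaussian integral. -/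
theorem integral_cexp_sq_gaussianReal (s : ℝ) :
    (∫ x, cexp (s * (x : ℂ) ^ 2 * I) ∂(gaussianReal 0 (1 / 2))) ^ 2 = 1 / (1 - s * I) := by
  have hre : 0 < (1 - s * I : ℂ).re := by simp
  have hne : (1 - s * I : ℂ) ≠ 0 := by
    intro h
    rw [h] at hre
    simp at hre
  have hpi : (Real.pi : ℂ) ≠ 0 := by exact_mod_cast Real.pi_ne_zero
  have hv : (1 / 2 : NNReal) ≠ 0 := by norm_num
  have hfun : ∀ x : ℝ, gaussianPDFReal 0 (1 / 2) x • cexp (s * (x : ℂ) ^ 2 * I)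
      = ((√Real.pi)⁻¹ : ℝ) * cexp (-(1 - s * I) * (x : ℂ) ^ 2) := by
    intro x
    rw [gaussianPDFReal, real_smul]
    have h1 : 2 * Real.pi * ((1 / 2 : NNReal) : ℝ) = Real.pi := by
      push_cast
      ring
    have h2 : -(x - 0) ^ 2 / (2 * ((1 / 2 : NNReal) : ℝ)) = -x ^ 2 := by
      push_cast
      ring
    rw [h1, h2]
    push_cast
    rw [mul_assoc, ← Complex.exp_add]
    congr 2
    ring
  rw [integral_gaussianReal_eq_integral_smul hv]
  simp only [hfun]
  rw [integral_const_mul, integral_gaussian_complex hre, mul_pow, ← cpow_nat_mul,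
    ← ofReal_pow, inv_pow, Real.sq_sqrt Real.pi_pos.le]
  push_cast
  rw [mul_one_div_cancel two_ne_zero, cpow_one]
  field_simp

open Complex in
theorem integral_cexp_sq_norm_rayleighLaw (s : ℝ) :
    ∫ z, cexp (s * (‖z‖ ^ 2 : ℝ) * I) ∂rayleighLaw = 1 / (1 - s * I) := by
  rw [rayleighLaw, integral_map_equiv, ← integral_cexp_sq_gaussianReal, sq, ← integral_prod_mul]
  refine integral_congr_ae (Eventually.of_forall fun p => ?_)
  have hz : ‖Complex.measurableEquivRealProd.symm p‖ ^ 2 = p.1 ^ 2 + p.2 ^ 2 := by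
    rw [Complex.sq_norm, Complex.normSq_apply, sq, sq]
    rfl
  simp only [hz]
  rw [← Complex.exp_add]
  congr 1
  push_cast
  ring

variable {Ω : Type*} [MeasurableSpace Ω] {P : Measure Ω}

/-- Grouping a doubly indexed independent family along the first index keeps independence. -/
theorem iIndepFun_curry {ι κ E : Type*} [Countable ι] [Countable κ] [MeasurableSpace E]
    {X : ι × κ → Ω → E} (hX : ∀ p, AEMeasurable (X p) P) (h : iIndepFun X P) :
    iIndepFun (fun i ω j => X (i, j) ω) P := by
  have := h.isProbabilityMeasure
  have hprob : ∀ i j, IsProbabilityMeasure (P.map (X (i, j))) := fun i j =>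
    Measure.isProbabilityMeasure_map (hX _)
  have hrow : ∀ i, AEMeasurable (fun ω j => X (i, j) ω) P := fun i =>
    aemeasurable_pi_lambda _ fun j => hX (i, j)
  have hjoint : AEMeasurable (fun ω p => X p ω) P := aemeasurable_pi_lambda _ hX
  rw [iIndepFun_iff_map_fun_eq_infinitePi_map₀ (aemeasurable_pi_lambda _ hrow)]
  have h2 : ∀ i, P.map (fun ω j => X (i, j) ω)
      = Measure.infinitePi fun j => P.map (X (i, j)) := fun i =>
    (iIndepFun_iff_map_fun_eq_infinitePi_map₀ (hrow i)).1
      (h.precomp (g := fun j => (i, j)) (Prod.mk_right_injective i))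
  simp only [h2]
  rw [← Measure.infinitePi_map_curry fun i j => P.map (X (i, j)),
    ← (iIndepFun_iff_map_fun_eq_infinitePi_map₀ hjoint).1 h,
    AEMeasurable.map_map_of_aemeasurable (MeasurableEquiv.measurable _).aemeasurable hjoint]
  rfl

/-- Both sides have the characteristic function `(r / (r - i t)) ^ Nt`, a power of that of the
exponential law of `|h k|² / r`. -/
theorem map_norm_sq_rayleigh {Nt : ℕ} (hNt : 0 < Nt) {h : Ω → EuclideanSpace ℂ (Fin Nt)}
    (hind : iIndepFun (fun k ω => h ω k) P) (hlaw : ∀ k, HasLaw (fun ω => h ω k) rayleighLaw P)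
    {r : ℝ} (hr : 0 < r) :
    P.map (fun ω => r⁻¹ * ‖h ω‖ ^ 2) = gammaMeasure Nt r := by
  have hP := hind.isProbabilityMeasure
  have hN : (0 : ℝ) < Nt := by exact_mod_cast hNt
  have hsq : Measurable fun z : ℂ => r⁻¹ * ‖z‖ ^ 2 := by fun_prop
  have hX : ∀ k, AEMeasurable (fun ω => r⁻¹ * ‖h ω k‖ ^ 2) P := fun k =>
    hsq.comp_aemeasurable (hlaw k).aemeasurable
  have hfun : (fun ω => r⁻¹ * ‖h ω‖ ^ 2) = fun ω => ∑ k, r⁻¹ * ‖h ω k‖ ^ 2 := by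
    funext ω
    rw [EuclideanSpace.norm_sq_eq, Finset.mul_sum]
  have hprob : IsProbabilityMeasure (P.map fun ω => r⁻¹ * ‖h ω‖ ^ 2) := by
    refine Measure.isProbabilityMeasure_map ?_
    rw [hfun]
    exact Finset.aemeasurable_fun_sum _ fun k _ => hX k
  have hgamma := isProbabilityMeasure_gammaMeasure hN hr
  have hone : ∀ t k, charFun (P.map fun ω => r⁻¹ * ‖h ω k‖ ^ 2) t = r / (r - t * Complex.I) := by
    intro t k
    rw [charFun_apply_real, integral_map (hX k) (by fun_prop)]
    have hcomp : ∫ ω, Complex.exp (t * ((r⁻¹ * ‖h ω k‖ ^ 2 : ℝ) : ℂ) * Complex.I) ∂P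
        = ∫ z, Complex.exp ((t / r : ℝ) * (‖z‖ ^ 2 : ℝ) * Complex.I) ∂rayleighLaw := by
      rw [← (hlaw k).map_eq, integral_map (hlaw k).aemeasurable
        (Measurable.aestronglyMeasurable (by fun_prop))]
      refine integral_congr_ae (Eventually.of_forall fun ω => ?_)
      simp only
      congr 1
      push_cast
      ring
    rw [hcomp, integral_cexp_sq_norm_rayleighLaw]
    have hr' : (r : ℂ) ≠ 0 := by exact_mod_cast hr.ne'
    push_cast
    rw [← mul_div_mul_left _ _ hr']
    congr 1
    · ring
    · field_simp
  refine Measure.ext_of_charFun (funext fun t => ?_)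
  rw [charFun_gammaMeasure hNt hr, hfun,
    (hind.comp (fun _ z => r⁻¹ * ‖z‖ ^ 2) fun _ => hsq).charFun_map_fun_sum_eq_prod hX,
    Finset.prod_apply]
  simp only [hone, Finset.prod_const, Finset.card_univ, Fintype.card_fin]

variable {Tf Nt : ℕ} {α : Fin Tf → ℝ} {σ : ℝ} {G : (Ts : ℕ) → Fin (Tf * Ts) → Ω → ℝ}

theorem IsIIDGain.isIndepSample (hG : IsIIDGain P α σ Nt G) (Ts : ℕ) :
    IsIndepSample P (G Ts) (gainLaw α σ Nt) := by
  refine ⟨fun t => (hG.2 Ts t).aemeasurable, hG.1 Ts, ?_⟩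
  have h1 : ∀ t, P.map (G Ts t) = gainLaw α σ Nt := fun t => (hG.2 Ts t).map_eq
  simp only [h1, Finset.sum_const, Finset.card_univ, Fintype.card_fin, Nat.cast_smul_eq_nsmul]

theorem IsBlockFadingGain.isIndepSample (hTf : 0 < Tf) (hNt : 0 < Nt) (hα : ∀ j, 0 < α j)
    (hσ : 0 < σ) (hG : IsBlockFadingGain P α σ Nt G) (Ts : ℕ) :
    IsIndepSample P (G Ts) (gainLaw α σ Nt) := by
  obtain ⟨h, hind, hlaw, hgain⟩ := hG
  have hr : ∀ j, 0 < σ ^ 2 / α j := fun j => div_pos (by positivity) (hα j)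
  have hfun : ∀ t, G Ts t = fun ω => (σ ^ 2 / α t.divNat)⁻¹ * ‖h Ts t ω‖ ^ 2 := by
    intro t
    funext ω
    rw [hgain, inv_div]
    ring
  have hmap : ∀ t, P.map (G Ts t) = gammaMeasure Nt (σ ^ 2 / α t.divNat) := by
    intro t
    rw [hfun]
    exact map_norm_sq_rayleigh hNt
      ((hind Ts).precomp (g := fun k => (t, k)) (Prod.mk_right_injective t)) (hlaw Ts t) (hr _)
  have hcurry := iIndepFun_curry (X := fun (p : Fin (Tf * Ts) × Fin Nt) ω => h Ts p.1 ω p.2)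
    (fun p => (hlaw Ts p.1 p.2).aemeasurable) (hind Ts)
  have hnorm : ∀ t : Fin (Tf * Ts), Measurable fun v : Fin Nt → ℂ =>
      (σ ^ 2 / α (Fin.divNat t))⁻¹ * ∑ k, ‖v k‖ ^ 2 := fun t => by fun_prop
  refine ⟨fun t => ?_, ?_, ?_⟩
  · refine AEMeasurable.of_map_ne_zero ?_
    have hN : (0 : ℝ) < Nt := by exact_mod_cast hNt
    have := isProbabilityMeasure_gammaMeasure hN (hr t.divNat)
    rw [hmap]
    exact IsProbabilityMeasure.ne_zero _
  · convert! hcurry.comp (fun t v => (σ ^ 2 / α (Fin.divNat t))⁻¹ * ∑ k, ‖v k‖ ^ 2) hnorm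
      using 2 with t
    rw [hfun]
    funext ω
    simp [EuclideanSpace.norm_sq_eq]
  · simp only [hmap]
    rw [gainLaw_eq_average hNt hα hσ, ← finProdFinEquiv.sum_comp, Fintype.sum_prod_type]
    have hdiv : ∀ (j : Fin Tf) (s : Fin Ts), (finProdFinEquiv (j, s)).divNat = j := fun j s =>
      congrArg Prod.fst (finProdFinEquiv.symm_apply_apply (j, s))
    simp only [hdiv, Finset.sum_const, Finset.card_univ, Fintype.card_fin]
    have hTf0 : (Tf : ENNReal) ≠ 0 := by exact_mod_cast hTf.ne'
    rw [← Finset.smul_sum, smul_smul, Nat.cast_mul, mul_right_comm,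
      ENNReal.mul_inv_cancel hTf0 (ENNReal.natCast_ne_top _), one_mul, Nat.cast_smul_eq_nsmul]

end BlockFading

end PredictiveAllocation

end

open PredictiveAllocation in
theorem proposition3 {Ω : Type*} [MeasurableSpace Ω] (P : Measure Ω) [IsProbabilityMeasure P]
    (Tf Nt : ℕ) (hTf : 0 < Tf) (hNt : 0 < Nt)
    (α : Fin Tf → ℝ) (hα : ∀ j, 0 < α j) (σ : ℝ) (hσ : 0 < σ)
    -- the equivalent channel gains of the `T = Tf * Ts` slots
    (G : (Ts : ℕ) → Fin (Tf * Ts) → Ω → ℝ)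
    (hG : IsBlockFadingGain P α σ Nt G ∨ IsIIDGain P α σ Nt G)
    -- the active ratio `κ` and the number of scheduled slots
    (κ : ℝ) (hκ0 : 0 < κ) (hκ1 : κ < 1) (N : ℕ → ℕ)
    (hN : Tendsto (fun Ts => (N Ts : ℝ) / ((Tf * Ts : ℕ) : ℝ)) atTop (𝓝 κ))
    -- the demand in nats
    (R : ℕ → ℝ) (hR : ∀ Ts, 0 < R Ts) (ρ : ℝ)
    (hRρ : Tendsto (fun Ts => R Ts / ((Tf * Ts : ℕ) : ℝ)) atTop (𝓝 ρ))
    -- the quantile `g_[1-κ]` and the constants `μ_Φ`, `μ_g`, `lim μ_ν`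
    (q : ℝ) (hq : ∫ g in Set.Ioi q, gainPDF α σ Nt g = κ)
    (μΦ μg ν_lim : ℝ)
    (hμΦ : μΦ = ∫ g in Set.Ioi q, Real.log g * gainPDF α σ Nt g / κ)
    (hμg : μg = ∫ g in Set.Ioi q, 1 / (g * κ) * gainPDF α σ Nt g)
    (hν_lim : ν_lim = Real.exp (ρ / κ - μΦ)) :
    -- the level and the power given by the formulas valid for `ν g_th ≥ 1`
    (HasMeanLimitAndConcentrates (fun _ => P)
        (fun Ts ω => fullLevel (fun t => G Ts t ω) (N Ts) (R Ts)) ν_lim ∧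
      HasMeanLimitAndConcentrates (fun _ => P)
        (fun Ts ω => fullPower (fun t => G Ts t ω) (N Ts) (R Ts)) (κ * ν_lim - κ * μg)) ∧
    -- the actual level and the actual power, when `ν g_th ≥ 1`
    ∀ ν : ℕ → Ω → ℝ, (∀ Ts, AEMeasurable (ν Ts) P) →
      (∀ᶠ Ts in atTop, ∀ᵐ ω ∂P, IsWaterLevel (fun t => G Ts t ω) (N Ts) (R Ts) (ν Ts ω)) →
      -- conditionally on this event, if its probability does not vanish
      ((∃ c : ℝ, 0 < c ∧ ∀ᶠ Ts in atTop,
          c ≤ P.real {ω | 1 ≤ ν Ts ω * threshold (fun t => G Ts t ω) (N Ts)}) →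
        HasMeanLimitAndConcentrates
          (fun Ts => P[|{ω | 1 ≤ ν Ts ω * threshold (fun t => G Ts t ω) (N Ts)}])
          ν ν_lim ∧
        HasMeanLimitAndConcentrates
          (fun Ts => P[|{ω | 1 ≤ ν Ts ω * threshold (fun t => G Ts t ω) (N Ts)}])
          (fun Ts ω => transmitPower (fun t => G Ts t ω) (N Ts) (ν Ts ω))
          (κ * ν_lim - κ * μg)) ∧
      -- unconditionally, if its probability tends to one
      (Tendsto (fun Ts => P.real {ω | 1 ≤ ν Ts ω * threshold (fun t => G Ts t ω) (N Ts)})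
          atTop (𝓝 1) →
        HasMeanLimitAndConcentrates (fun _ => P) ν ν_lim ∧
        HasMeanLimitAndConcentrates (fun _ => P)
          (fun Ts ω => transmitPower (fun t => G Ts t ω) (N Ts) (ν Ts ω))
          (κ * ν_lim - κ * μg)) := by
  have hμ := isRegularGainLaw_gainLaw hTf hNt hα hσ
  have hprob := hμ.isProbabilityMeasure
  have hsample : ∀ Ts, IsIndepSample P (G Ts) (gainLaw α σ Nt) := fun Ts =>
    hG.elim (fun h => h.isIndepSample hTf hNt hα hσ Ts) fun h => h.isIndepSample Ts
  have hn : Tendsto (fun Ts => Tf * Ts) atTop atTop := tendsto_id.const_mul_atTop' hTf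
  have hqμ : (gainLaw α σ Nt).real (Set.Ioi q) = κ := by
    have h1 := setIntegral_gainLaw hNt hα hσ (fun _ => 1) (measurableSet_Ioi (a := q))
    rw [setIntegral_const, smul_eq_mul, mul_one] at h1
    simpa only [one_mul, hq] using h1
  -- A nonpositive `q` would give `κ = 1`.
  have hq0 : 0 < q := by
    by_contra! hq'
    have h1 : (gainLaw α σ Nt).real (Set.Ioi q) = 1 := by
      have hae : Set.Ioi q =ᵐ[gainLaw α σ Nt] Set.univ :=
        eventuallyEq_univ.2 (hμ.ae_pos.mono fun x hx => hq'.trans_lt hx)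
      rw [measureReal_congr hae, probReal_univ]
    linarith
  have hlog : μΦ = (∫ x in Set.Ioi q, Real.log x ∂(gainLaw α σ Nt)) / κ := by
    rw [hμΦ, integral_div, setIntegral_gainLaw hNt hα hσ _ measurableSet_Ioi]
  have hinv : κ * μg = ∫ x in Set.Ioi q, 1 / x ∂(gainLaw α σ Nt) := by
    rw [hμg, ← integral_const_mul, setIntegral_gainLaw hNt hα hσ _ measurableSet_Ioi]
    refine integral_congr_ae (Eventually.of_forall fun g => ?_)
    simp only
    rw [← mul_assoc, mul_one_div, mul_comm g κ, ← div_div, div_self hκ0.ne']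
  have hF := tendstoMeanSq_fullLevel hμ hsample hn hκ0 hκ1 hN hRρ hq0 hqμ
  have hF' := tendstoMeanSq_fullPower hμ hsample hn hκ0 hκ1 hN hRρ hq0 hqμ
  rw [← hlog, ← hν_lim] at hF hF'
  rw [← hinv] at hF'
  have hP : ∀ᶠ k in (atTop : Filter ℕ), IsProbabilityMeasure ((fun _ => P) k) :=
    Eventually.of_forall fun _ => inferInstance
  refine ⟨⟨hF.hasMeanLimitAndConcentrates hP, hF'.hasMeanLimitAndConcentrates hP⟩,
    fun ν hνm hν => ?_⟩
  exact hasMeanLimitAndConcentrates_waterLevel hμ hsample hn hκ0 hκ1 hN hF hF' hνm hν
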